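/- Let $0\le r\le n$ be integers, $M=\bigoplus_{j\ge 0}\mathbb Z b_j$, $\sigma_nM=\bigoplus_{j\ge n}\mathbb Z b_j$ and $M_n=\bigoplus_{0\le j<n}\mathbb Z b_j\cong M/\sigma_nM$. Let $B_r=\mathbb Z[e_1,\dots,e_r]$, $E_r(z)=1-e_1z+\cdots+(-1)^re_rz^r$, $\sum_{j\ge0}h_jz^j=1/E_r(z)$, $h_j=0$ for $j<0$, $H_r=(h_j)_{j\in\mathbb Z}$. Let $I_{r,n}=(h_{n-r+1},\dots,h_n)\subset B_r$, $B_{r,n}=B_r/I_{r,n}$ (the cohomology ring of $G(r,n)$), $\pi_{r,n}:B_r\to B_{r,n}$ the projection (extended coefficientwise to formal series in $z,w$), and $H_{r,n}=\pi_{r,n}H_r$. For a partition $\lambda=(\lambda_1\ge\dots\ge\lambda_r\ge0)$ put $\Delta_\lambda(H)=\det(H_{\lambda_j-j+i})_{1\le i,j\le r}$ and $[b]^r_\lambda=b_{r-1+\lambda_1}\wedge b_{r-2+\lambda_2}\wedge\cdots\wedge b_{\lambda_r}$. For $i\ge 0$ let $\sigma_i$ be the coefficient of $z^i$ in the multiplicative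 map $\sigma_+(z):\bigwedge M\to(\bigwedge M)[[z]]$ with $\sigma_+(z)b_j=\sum_{i\ge0}b_{i+j}z^i$; define $\sigma_i$ on $\bigwedge M_n$ in the same way, with $b_k=0$ for $k\ge n$. Then there is exactly one $\mathbb Z$-module isomorphism $\phi_r:B_r\to\bigwedge^rM$ with $\phi_r(1)=[b]^r_0$ and $\phi_r(h_iP)=\sigma_i\phi_r(P)$ for all $i\ge 0$ and $P\in B_r$, and exactly one $\mathbb Z$-module isomorphism $\phi_{r,n}:B_{r,n}\to\bigwedge^rM_n$ with $\phi_{r,n}(1)=[b]^r_0$ and $\phi_{r,n}(\pi_{r,n}(h_i)P)=\sigma_i\phi_{r,n}(P)$ for all $i\ge 0$ and $P\in B_{r,n}$. Moreover $\phi_r(\Delta_\lambda(H_r))=[b]^r_\lambda$ for every such $\lambda$; $\phi_{r,n}\circ\pi_{r,n}$ is $\phi_r$ followed by the projection $\bigwedge^rM\to\bigwedge^rM_n$; and, if $r\ge1$, $\phi_r(I_{r,n})=\sigma_nM\wedge\bigwedge^{r-1}M$. An endomorphism $A$ of $M$ (respectively of $M_n$) acts on the exterior algebra by the derivation $\delta(A)$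 extending $A$, hence on $B_r$ by $\phi_r^{-1}\delta(A)\phi_r$ (respectively on $B_{r,n}$ by $\phi_{r,n}^{-1}\delta(A)\phi_{r,n}$). Let $\mathcal E_{ij}$ be the endomorphism $b_k\mapsto\delta_{jk}b_i$ and $$\mathcal E(z,w)=\sum_{i,j\ge0}\mathcal E_{ij}z^iw^{-j}\ \text{ on } B_r,\qquad \mathcal E(z,w)_n=\sum_{0\le i,j<n}\mathcal E_{ij}z^iw^{-j}\ \text{ on } B_{r,n}.$$ Let $\overline\sigma_-(z)$ be the multiplicative map on $\bigwedge M$, with values in $(\bigwedge M)[[z^{-1}]]$, such that $\overline\sigma_-(z)b_j=b_j-b_{j-1}z^{-1}$ (with $b_{-1}=0$), transported by $\phi_r$ to a $\mathbb Z$-linear map $\overline\sigma_-(z):B_r\to B_r[z^{-1}]$ and extended to $B_r[w,w^{-1}]$ coefficientwise in $w$. For $r\ge 1$ and a sequence $H$ let $\Delta_\lambda(w^{-\lambda},H)$ be the determinant whose first row is $(w^{-\lambda_1},w^{1-\lambda_2},\dots,w^{r-1-\lambda_r})$ and whose rows $i=2,\dots,r$ are $(H_{\lambda_j-j+i})_{1\le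 j\le r}$. Then for every partition $\lambda$ contained in the $r\times(n-r)$ rectangle, that is, with $n-r\ge\lambda_1\ge\dots\ge\lambda_r\ge0$, $$\mathcal E(z,w)_n\Delta_\lambda(H_{r,n})=\pi_{r,n}\bigl(\mathcal E(z,w)\Delta_\lambda(H_r)\bigr),$$ and, if $r\ge1$, $$\mathcal E(z,w)_n\Delta_\lambda(H_{r,n})=\frac{z^{r-1}}{w^{r-1}}\,\pi_{r,n}\!\left(\frac1{E_r(z)}\right)\pi_{r,n}\overline\sigma_-(z)\Delta_\lambda(w^{-\lambda},H_r)$$ $$=\frac{z^{r-1}}{w^{r-1}}\bigl(1+h_1z+\cdots+h_{n-r}z^{n-r}\bigr)\,\pi_{r,n}\overline\sigma_-(z)\Delta_\lambda(w^{-\lambda},H_r),$$ where in the last line $h_k$ stands for $\pi_{r,n}(h_k)$, and where $\overline\sigma_-(z)\Delta_\lambda(w^{-\lambda},H_r)=\Delta_\lambda(w^{-\lambda},\overline\sigma_-(z)H_r)$ with $\overline\sigma_-(z)H_r=(h_j-h_{j-1}z^{-1})_{j\in\mathbb Z}$. -/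

import Mathlib

noncomputable section

namespace SchubertGL

/-! ### Hasse-Schmidt derivations on an exterior algebra -/

section HasseSchmidt

variable {R V : Type} [CommRing R] [AddCommGroup V] [Module R V]

/-- The formal power series `∑ i, D i v * T ^ i` with coefficients in `V = ⋀¹ V ⊆ ⋀ V`. -/
def hsGen (D : ℕ → Module.End R V) : V →ₗ[R] PowerSeries (ExteriorAlgebra R V) where
  toFun v := PowerSeries.mk fun i => ExteriorAlgebra.ι R (D i v)
  map_add' u v := by ext; simp
  map_smul' c v := by
    ext i
    rw [RingHom.id_apply, PowerSeries.coeff_smul, PowerSeries.coeff_mk, PowerSeries.coeff_mk,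
      map_smul, map_smul]

theorem hsGen_sq (D : ℕ → Module.End R V) (v : V) : hsGen D v * hsGen D v = 0 := by
  ext n
  rw [PowerSeries.coeff_mul]
  simp only [hsGen, LinearMap.coe_mk, AddHom.coe_mk, PowerSeries.coeff_mk, map_zero]
  refine Finset.sum_involution (fun p _ => (p.2, p.1)) ?_ ?_ ?_ ?_
  · intro p _
    exact ExteriorAlgebra.ι_add_mul_swap _ _
  · intro p _ hp h
    apply hp
    have h1 : p.2 = p.1 := congrArg Prod.fst h
    rw [h1]
    exact ExteriorAlgebra.ι_sq_zero _
  · intro p hp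
    simpa [add_comm] using hp
  · intro p _
    rfl

/-- The Hasse-Schmidt derivation `⋀ V → (⋀ V)[[T]]`, `D(T)(u ∧ v) = D(T)u ∧ D(T)v`, which on
`V = ⋀¹ V` is `v ↦ ∑ i, D i v * T ^ i`. -/
def hs (D : ℕ → Module.End R V) :
    ExteriorAlgebra R V →ₐ[R] PowerSeries (ExteriorAlgebra R V) :=
  ExteriorAlgebra.lift R ⟨hsGen D, hsGen_sq D⟩

theorem hs_ι (D : ℕ → Module.End R V) (v : V) :
    hs D (ExteriorAlgebra.ι R v) = PowerSeries.mk fun i => ExteriorAlgebra.ι R (D i v) := by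
  rw [hs, ExteriorAlgebra.lift_ι_apply]
  rfl

theorem coeff_hs_mem (D : ℕ → Module.End R V) {r : ℕ} {u : ExteriorAlgebra R V}
    (hu : u ∈ ⋀[R]^r V) : ∀ i : ℕ, PowerSeries.coeff i (hs D u) ∈ ⋀[R]^r V := by
  induction hu using Submodule.pow_induction_on_left' with
  | algebraMap c =>
    intro i
    rw [AlgHom.commutes, PowerSeries.algebraMap_apply, PowerSeries.coeff_C]
    split_ifs
    · exact Submodule.algebraMap_mem c
    · exact Submodule.zero_mem _
  | add x y k hx hy ihx ihy =>
    intro i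
    rw [map_add, map_add]
    exact Submodule.add_mem _ (ihx i) (ihy i)
  | mem_mul m hm k x hx ih =>
    intro i
    obtain ⟨v, rfl⟩ := hm
    rw [map_mul, hs_ι, PowerSeries.coeff_mul]
    refine Submodule.sum_mem _ fun p _ => ?_
    rw [PowerSeries.coeff_mk, Nat.succ_eq_add_one, ExteriorAlgebra.exteriorPower, pow_succ']
    exact Submodule.mul_mem_mul ⟨_, rfl⟩ (ih p.2)

/-- The coefficient of `T ^ i` in `hs D`, as an endomorphism of `⋀^r V`. -/
def hsCoeff (r : ℕ) (D : ℕ → Module.End R V) (i : ℕ) : ⋀[R]^r V →ₗ[R] ⋀[R]^r V where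
  toFun u := ⟨PowerSeries.coeff i (hs D u), coeff_hs_mem D u.2 i⟩
  map_add' u v := by ext; simp
  map_smul' c u := by
    ext1
    change PowerSeries.coeff i (hs D (c • (u : ExteriorAlgebra R V))) = _
    rw [map_smul, PowerSeries.coeff_smul]
    rfl

/-- The sequence `1, A, 0, 0, …`. -/
def linSeq (A : Module.End R V) : ℕ → Module.End R V
  | 0 => 1
  | 1 => A
  | _ + 2 => 0

/-- The action of `A ∈ gl(V)` on `⋀ V` by the derivation extending `A`: the coefficient of `T` in
the Hasse-Schmidt derivation extending `v ↦ v + A v * T`. See `extAct_ι` and `extAct_mul`. -/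
def extAct (A : Module.End R V) : ExteriorAlgebra R V →ₗ[R] ExteriorAlgebra R V where
  toFun u := PowerSeries.coeff 1 (hs (linSeq A) u)
  map_add' u v := by simp
  map_smul' c u := by
    rw [map_smul, PowerSeries.coeff_smul]
    rfl

theorem extAct_ι (A : Module.End R V) (v : V) :
    extAct A (ExteriorAlgebra.ι R v) = ExteriorAlgebra.ι R (A v) := by
  simp [extAct, hs_ι, linSeq]

theorem coeff_zero_hs_linSeq (A : Module.End R V) (u : ExteriorAlgebra R V) :
    PowerSeries.coeff 0 (hs (linSeq A) u) = u := by
  induction u using ExteriorAlgebra.induction with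
  | algebraMap c => rw [AlgHom.commutes, PowerSeries.algebraMap_apply]; simp
  | ι v => simp [hs_ι, linSeq]
  | mul a b ha hb => rw [map_mul, PowerSeries.coeff_mul]; simp [ha, hb]
  | add a b ha hb => rw [map_add, map_add, ha, hb]

theorem extAct_mul (A : Module.End R V) (u v : ExteriorAlgebra R V) :
    extAct A (u * v) = extAct A u * v + u * extAct A v := by
  have h : Finset.HasAntidiagonal.antidiagonal (1 : ℕ) = {((0 : ℕ), 1), (1, 0)} := rfl
  simp only [extAct, LinearMap.coe_mk, AddHom.coe_mk, map_mul, PowerSeries.coeff_mul, h]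
  rw [Finset.sum_pair (by simp), coeff_zero_hs_linSeq, coeff_zero_hs_linSeq, add_comm]

/-- The representation `δ(A)` of `A ∈ gl(V)` on `⋀^r V`. -/
def delta (r : ℕ) (A : Module.End R V) : ⋀[R]^r V →ₗ[R] ⋀[R]^r V :=
  hsCoeff r (linSeq A) 1

theorem coe_delta (r : ℕ) (A : Module.End R V) (u : ⋀[R]^r V) :
    (delta r A u : ExteriorAlgebra R V) = extAct A u := rfl

end HasseSchmidt

/-! ### The free modules `M` and `M_n` -/

/-- `M = ⨁_{i ≥ 0} ℤ b_i`. -/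
abbrev M : Type := ℕ →₀ ℤ

/-- `M_n = ⨁_{0 ≤ i < n} ℤ b_i`. -/
abbrev Mn (n : ℕ) : Type := Fin n →₀ ℤ

/-- The basis element `b_j` of `M`. -/
def b (j : ℕ) : M := Finsupp.single j 1

/-- The basis element `b_j` of `M_n` for `j < n`, and `0` for `j ≥ n`. -/
def bn (n j : ℕ) : Mn n := if h : j < n then Finsupp.single ⟨j, h⟩ 1 else 0

/-- The projection `M → M_n` with kernel `σ_n M`. -/
def proj (n : ℕ) : M →ₗ[ℤ] Mn n := Finsupp.linearCombination ℤ (bn n)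

/-- `σ_n M = ⨁_{j ≥ n} ℤ b_j`. -/
def sigmaM (n : ℕ) : Submodule ℤ M := Submodule.span ℤ {v | ∃ j, n ≤ j ∧ v = b j}

/-- The elementary endomorphism `ℰ_{ij} = b_i ⊗ β_j`, `b_k ↦ δ_{jk} b_i`. -/
def elem {α : Type} (i j : α) : Module.End ℤ (α →₀ ℤ) :=
  Finsupp.lsingle i ∘ₗ Finsupp.lapply j

/-- `σ_i b_j = b_{i + j}` on `M`. -/
def shift (i : ℕ) : Module.End ℤ M := Finsupp.linearCombination ℤ fun j => b (i + j)

/-- `σ_i b_j = b_{i + j}` on `M_n`, with `b_k = 0` for `k ≥ n`. -/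
def shiftn (n i : ℕ) : Module.End ℤ (Mn n) :=
  Finsupp.linearCombination ℤ fun j : Fin n => bn n (i + j)

/-- `σ_{-1} b_j = b_{j - 1}` for `j ≥ 1` and `σ_{-1} b_0 = 0`. -/
def shiftDown : Module.End ℤ M :=
  Finsupp.linearCombination ℤ fun j => if j = 0 then 0 else b (j - 1)

/-- `σ_i` on `⋀^r M`: the coefficient of `z ^ i` in the Schubert derivation `σ_+(z)`. -/
def sigmaPlus (r i : ℕ) : ⋀[ℤ]^r M →ₗ[ℤ] ⋀[ℤ]^r M := hsCoeff r shift i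

/-- `σ_i` on `⋀^r M_n`. -/
def sigmaPlusN (r n i : ℕ) : ⋀[ℤ]^r (Mn n) →ₗ[ℤ] ⋀[ℤ]^r (Mn n) := hsCoeff r (shiftn n) i

/-- The coefficient of `z ^ (-i)` in the Schubert derivation `\bar σ_-(z)` on `⋀^r M`. Being the
inverse of `σ_-(z)`, which on `M` is `∑ i, (σ_{-1}) ^ i z ^ (-i)`, it is the Hasse-Schmidt
derivation which on `M` is `1 - σ_{-1} z⁻¹`. -/
def sigmaBarCoeff (r i : ℕ) : ⋀[ℤ]^r M →ₗ[ℤ] ⋀[ℤ]^r M := hsCoeff r (linSeq (-shiftDown)) i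

/-- `[b]^r_λ = b_{r - 1 + λ_1} ∧ … ∧ b_{λ_r}` in `⋀^r M`. The parts of the partition are
`λ 0 ≥ λ 1 ≥ … ≥ λ (r - 1)`. -/
def wedge {r : ℕ} (lam : Fin r → ℕ) : ⋀[ℤ]^r M :=
  exteriorPower.ιMulti ℤ r fun i => b ((i.rev : ℕ) + lam i)

/-- `[b]^r_λ` in `⋀^r M_n`. -/
def wedgeN (n : ℕ) {r : ℕ} (lam : Fin r → ℕ) : ⋀[ℤ]^r (Mn n) :=
  exteriorPower.ιMulti ℤ r fun i => bn n ((i.rev : ℕ) + lam i)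

/-! ### The rings `B_r` and `B_{r,n}` -/

/-- `B_r = ℤ[e_1, …, e_r]`; the variable `e_{i+1}` is `X i`. -/
abbrev B (r : ℕ) : Type := MvPolynomial (Fin r) ℤ

/-- `E_r(z) = 1 - e_1 z + … + (-1)^r e_r z^r`. -/
def E (r : ℕ) : PowerSeries (B r) :=
  1 + ∑ i : Fin r,
    PowerSeries.C ((-1) ^ ((i : ℕ) + 1) * MvPolynomial.X i) * PowerSeries.X ^ ((i : ℕ) + 1)

theorem constantCoeff_E (r : ℕ) : PowerSeries.constantCoeff (E r) = ((1 : (B r)ˣ) : B r) := by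
  simp [E]

/-- `1 / E_r(z)`. -/
def invE (r : ℕ) : PowerSeries (B r) := PowerSeries.invOfUnit (E r) 1

theorem E_mul_invE (r : ℕ) : E r * invE r = 1 :=
  PowerSeries.mul_invOfUnit _ _ (constantCoeff_E r)

/-- The sequence `H_r = (h_j)_{j ∈ ℤ}`, `∑_{j ≥ 0} h_j z^j = 1 / E_r(z)`, `h_j = 0` for `j < 0`. -/
def h (r : ℕ) : ℤ → B r
  | Int.ofNat j => PowerSeries.coeff j (invE r)
  | Int.negSucc _ => 0

/-- The ideal `I_{r,n} = (h_{n-r+1}, …, h_n)` of `B_r`. -/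
def I (r n : ℕ) : Ideal (B r) := Ideal.span {x | ∃ k : ℕ, n + 1 ≤ k + r ∧ k ≤ n ∧ x = h r k}

/-- `B_{r,n} = B_r / (h_{n-r+1}, …, h_n)`. -/
abbrev Bn (r n : ℕ) : Type := B r ⧸ I r n

/-- The canonical epimorphism `π_{r,n} : B_r → B_{r,n}`. -/
def pi (r n : ℕ) : B r →+* Bn r n := Ideal.Quotient.mk (I r n)

/-- `Δ_λ(H) = det (H_{λ_j - j + i})`. -/
def schur {A : Type} [CommRing A] {r : ℕ} (lam : Fin r → ℕ) (H : ℤ → A) : A :=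
  Matrix.det (Matrix.of fun i j : Fin r => H ((lam j : ℤ) - (j : ℤ) + (i : ℤ)))

/-- `Δ_λ(w^{-λ}, H)`: the determinant whose first row is `w^{-λ_1}, w^{1-λ_2}, …, w^{r-1-λ_r}`, and
whose other rows are those of `Δ_λ(H)`. The argument `W` is the sequence `k ↦ w^k`. -/
def schurW {A : Type} [CommRing A] {r : ℕ} (lam : Fin r → ℕ) (W H : ℤ → A) : A :=
  Matrix.det (Matrix.of fun i j : Fin r =>
    if (i : ℕ) = 0 then W ((j : ℤ) - (lam j : ℤ)) else H ((lam j : ℤ) - (j : ℤ) + (i : ℤ)))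

/-! ### Formal series in `z` and `w⁻¹` -/

section Series

/-- The ring `R((z))((w⁻¹))`: Laurent series in `w⁻¹` whose coefficients are Laurent series in `z`.
It contains `R[z, z⁻¹, w, w⁻¹]` and `R[[z, w⁻¹]]`. -/
abbrev L (R : Type) [CommRing R] : Type := LaurentSeries (LaurentSeries R)

variable {R S : Type} [CommRing R] [CommRing S]

/-- Constants. -/
def cst : R →+* L R := (HahnSeries.C : LaurentSeries R →+* L R).comp HahnSeries.C

/-- `z ^ k`. -/
def zpw (k : ℤ) : L R := HahnSeries.C (HahnSeries.single k (1 : R))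

/-- `w ^ k`. -/
def wpw (k : ℤ) : L R := HahnSeries.single (-k) (1 : LaurentSeries R)

/-- A power series in `z`. -/
def ofZ (f : PowerSeries R) : L R := HahnSeries.C (HahnSeries.ofPowerSeries ℤ R f)

/-- A map applied to all coefficients. -/
def mapL (f : R →+* S) (x : L R) : L S :=
  x.map (⟨fun y => y.map f, by ext; simp⟩ : ZeroHom (LaurentSeries R) (LaurentSeries S))

/-- The series `∑_{i, j ≥ 0} a i j z^i w^{-j}`. -/
def ofCoeffs (a : ℕ → ℕ → R) : L R :=
  HahnSeries.ofPowerSeries ℤ (LaurentSeries R)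
    (PowerSeries.mk fun j => HahnSeries.ofPowerSeries ℤ R (PowerSeries.mk fun i => a i j))

end Series

/-! ### The identifications with exterior powers and the actions -/

/-- `φ : B_r ≃ ⋀^r M` is `P ↦ P [b]^r_0` for the `B_r`-module structure in which `h_i` acts as
`σ_i`. -/
structure IsPhi (r : ℕ) (φ : B r ≃ₗ[ℤ] ⋀[ℤ]^r M) : Prop where
  one : φ 1 = wedge (fun _ : Fin r => 0)
  h_mul : ∀ (i : ℕ) (P : B r), φ (h r i * P) = sigmaPlus r i (φ P)

/-- `φ : B_{r,n} ≃ ⋀^r M_n` is `P ↦ P [b]^r_0` for the `B_{r,n}`-module structure in which `h_i`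
acts as `σ_i`. -/
structure IsPhiN (r n : ℕ) (φ : Bn r n ≃ₗ[ℤ] ⋀[ℤ]^r (Mn n)) : Prop where
  one : φ 1 = wedgeN n (fun _ : Fin r => 0)
  h_mul : ∀ (i : ℕ) (P : Bn r n), φ (pi r n (h r i) * P) = sigmaPlusN r n i (φ P)

/-- The action of an endomorphism of `V` on a module `X` identified with `⋀^r V`. -/
def act {V X : Type} [AddCommGroup V] [Module ℤ V] [AddCommGroup X] [Module ℤ X] {r : ℕ}
    (φ : X ≃ₗ[ℤ] ⋀[ℤ]^r V) (A : Module.End ℤ V) : X →ₗ[ℤ] X :=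
  φ.symm.toLinearMap ∘ₗ delta r A ∘ₗ φ.toLinearMap

/-- `ℰ(z,w) P = ∑_{i, j ≥ 0} (ℰ_{ij} P) z^i w^{-j}` for `P ∈ B_r`. -/
def genE {r : ℕ} (φ : B r ≃ₗ[ℤ] ⋀[ℤ]^r M) (P : B r) : L (B r) :=
  ofCoeffs fun i j => act φ (elem i j) P

/-- `ℰ(z,w)_n P = ∑_{0 ≤ i, j < n} (ℰ_{ij} P) z^i w^{-j}` for `P ∈ B_{r,n}`. -/
def genEn {r n : ℕ} (φ : Bn r n ≃ₗ[ℤ] ⋀[ℤ]^r (Mn n)) (P : Bn r n) : L (Bn r n) :=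
  ∑ i : Fin n, ∑ j : Fin n,
    cst (act φ (elem i j) P) * zpw ((i : ℕ) : ℤ) * wpw (-((j : ℕ) : ℤ))

theorem sigmaBarCoeff_eq_zero {r i : ℕ} (hi : r < i) (u : ⋀[ℤ]^r M) : sigmaBarCoeff r i u = 0 := by
  ext1
  change PowerSeries.coeff i (hs (linSeq (-shiftDown)) (u : ExteriorAlgebra ℤ M)) = 0
  obtain ⟨u, hu⟩ := u
  dsimp only
  induction hu using Submodule.pow_induction_on_left' generalizing i with
  | algebraMap c =>
    rw [AlgHom.commutes, PowerSeries.algebraMap_apply, PowerSeries.coeff_C, if_neg (by omega)]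
  | add x y k hx hy ihx ihy => rw [map_add, map_add, ihx hi, ihy hi, add_zero]
  | mem_mul m hm k x hx ih =>
    obtain ⟨v, rfl⟩ := hm
    rw [map_mul, hs_ι, PowerSeries.coeff_mul]
    refine Finset.sum_eq_zero fun p hp => ?_
    rw [PowerSeries.coeff_mk]
    have hp' : p.1 + p.2 = i := by simpa using hp
    rcases hq : p.1 with _ | _ | q
    · rw [ih (by omega), mul_zero]
    · rw [ih (by omega), mul_zero]
    · simp [linSeq]

/-- `\bar σ_-(z) : B_r → B_r[z⁻¹]`, `(\bar σ_-(z) P) [b]^r_0 = \bar σ_-(z) (P [b]^r_0)`. The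
coefficients of `z ^ (-i)` with `i > r` vanish by `sigmaBarCoeff_eq_zero`. -/
def sigmaBar {r : ℕ} (φ : B r ≃ₗ[ℤ] ⋀[ℤ]^r M) (P : B r) : L (B r) :=
  ∑ i ∈ Finset.range (r + 1), cst (φ.symm (sigmaBarCoeff r i (φ P))) * zpw (-(i : ℤ))

/-- The extension of `\bar σ_-(z)` to `B_r[w, w⁻¹]`, coefficient by coefficient in `w`. -/
def sigmaBarW {r : ℕ} (φ : B r ≃ₗ[ℤ] ⋀[ℤ]^r M) (x : LaurentPolynomial (B r)) : L (B r) :=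
  x.coeff.sum fun k P => wpw k * sigmaBar φ P

/-- `Δ_λ(w^{-λ}, H_r) ∈ B_r[w, w⁻¹]`. -/
def schurWH {r : ℕ} (lam : Fin r → ℕ) : LaurentPolynomial (B r) :=
  schurW lam LaurentPolynomial.T fun k => LaurentPolynomial.C (h r k)

/-- `Δ_λ(w^{-λ}, \bar σ_-(z) H_r)`, where `\bar σ_-(z) h_k = h_k - h_{k-1} z⁻¹`. -/
def schurWSigmaH {r : ℕ} (lam : Fin r → ℕ) : L (B r) :=
  schurW lam wpw fun k => cst (h r k) - cst (h r (k - 1)) * zpw (-1)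

end SchubertGL

end

noncomputable section

namespace SchubertGL

/-! The inverse of φ_r is explicit: ψ (`psi`) sends b_{a_1} ∧ ⋯ ∧ b_{a_r} to det (h_{a_j-r+1+i}), 0
≤ i < r, so that ψ([b]_λ) = Δ_λ(H_r) at once. It must be shown that ψ is bijective and turns σ_i
into multiplication by h_i. Embed B_r in ℤ[x_1, …, x_r] by elementary symmetric polynomials. Since
1/(1 - x_k z) = ∏_{m≠k} (1 - x_m z) / E_r(z), each x_k^a is a combination of h_{a-r+1}, …, h_a with
coefficients independent of a. Hence the alternant det (x_k^{a_j}) is a fixed nonzero multiple of ψ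
(`detForm_rootEval`). For the alternant, injectivity holds because its monomial coefficients include
the coordinates in ⋀^r M, and σ_+(z) multiplies row k by 1/(1 - x_k z), hence the determinant by
1/E_r(z). Surjectivity and uniqueness follow because the h_i generate B_r (`adjoin_h`).

By E_r · (1/E_r) = 1, the ideal I_{r,n} contains every h_k with k > n - r, so ψ descends to M_n. For
r ≥ 1, the preimage of I_{r,n} is σ_n M ∧ ⋀^{r-1} M, which is σ_i-stable and contains preimages of
the generators; this gives injectivity after truncation.

For the action, ℰ_{ij} replaces a factor b_j of [b]_λ by b_i. Summing over i with z^i turns the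
corresponding column into z^{r-1}/E_r(z) times (1, t, t², …), t = z⁻¹. Subtracting t times each row
from the next turns this column into a unit vector and h_k elsewhere into h_k - h_{k-1} t; the sum
over columns is then a first-row expansion (`genE_schur`). That `sigmaBarW` produces the same
determinant follows from multiplicativity of σ̄_-(z) (`sigmaBarW_schurWH`). Finally the projection
commutes with ℰ_{ij} for i, j < n, and the remaining terms vanish (`genEn_eq`). -/

theorem sum_antidiagonalTuple_succ {A : Type*} [AddCommMonoid A] (r n : ℕ)
    (g : (Fin (r + 1) → ℕ) → A) :
    ∑ k ∈ Finset.Nat.antidiagonalTuple (r + 1) n, g k =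
      ∑ p ∈ Finset.HasAntidiagonal.antidiagonal n, ∑ k ∈ Finset.Nat.antidiagonalTuple r p.2,
        g (Fin.cons p.1 k) := by
  rw [Finset.sum_sigma']
  symm
  refine Finset.sum_bij' (fun x _ => Fin.cons x.1.1 x.2)
    (fun k _ => ⟨(k 0, ∑ i, Fin.tail k i), Fin.tail k⟩) ?_ ?_ ?_ ?_ ?_
  · rintro ⟨⟨a, c⟩, k⟩ hk
    simp only [Finset.mem_sigma, Finset.HasAntidiagonal.mem_antidiagonal,
      Finset.Nat.mem_antidiagonalTuple] at hk ⊢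
    rw [Fin.sum_cons, hk.2, hk.1]
  · intro k hk
    simp only [Finset.mem_sigma, Finset.HasAntidiagonal.mem_antidiagonal,
      Finset.Nat.mem_antidiagonalTuple] at hk ⊢
    rw [Fin.sum_univ_succ] at hk
    exact ⟨hk, trivial⟩
  · rintro ⟨⟨a, c⟩, k⟩ hk
    simp only [Finset.mem_sigma, Finset.HasAntidiagonal.mem_antidiagonal,
      Finset.Nat.mem_antidiagonalTuple] at hk
    obtain ⟨-, rfl⟩ := hk
    simp
  · intro k _
    simp
  · intros
    rfl

/-- Ordered products, so that the formula serves both the noncommutative exterior algebra and the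
terms of a determinant. -/
theorem coeff_prod_ofFn {A : Type*} [Semiring A] : ∀ {r : ℕ} (F : Fin r → PowerSeries A) (n : ℕ),
    PowerSeries.coeff n (List.ofFn F).prod =
      ∑ k ∈ Finset.Nat.antidiagonalTuple r n,
        (List.ofFn fun j => PowerSeries.coeff (k j) (F j)).prod
  | 0, F, 0 => by simp
  | 0, F, n + 1 => by simp [PowerSeries.coeff_one]
  | r + 1, F, n => by
    rw [sum_antidiagonalTuple_succ, List.ofFn_succ, List.prod_cons, PowerSeries.coeff_mul]
    refine Finset.sum_congr rfl fun p _ => ?_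
    rw [coeff_prod_ofFn, Finset.mul_sum]
    simp [List.ofFn_succ]

/-! ### Determinantal forms and derivations on exterior powers -/

section DetForm

variable {V W S T : Type} [AddCommGroup V] [Module ℤ V] [AddCommGroup W] [Module ℤ W] [CommRing S]
  [CommRing T] {r : ℕ}

/-- The alternating map `v ↦ det (f i (v j))`. -/
def detAlternating (f : Fin r → V →ₗ[ℤ] S) : V [⋀^Fin r]→ₗ[ℤ] S where
  toMultilinearMap := (MultilinearMap.restrictScalars ℤ
    (Matrix.detRowAlternating (R := S) (n := Fin r)).toMultilinearMap).compLinearMap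
      fun _ => LinearMap.pi f
  map_eq_zero_of_eq' v _ _ hv hij :=
    (Matrix.detRowAlternating (R := S) (n := Fin r)).map_eq_zero_of_eq
      (fun k => LinearMap.pi f (v k)) (congrArg (LinearMap.pi f) hv) hij

/-- The linear form on `⋀^r V` given by the determinant `det (f i (v j))`. -/
def detForm (f : Fin r → V →ₗ[ℤ] S) : ⋀[ℤ]^r V →ₗ[ℤ] S :=
  exteriorPower.alternatingMapLinearEquiv (detAlternating f)

theorem detForm_ιMulti (f : Fin r → V →ₗ[ℤ] S) (v : Fin r → V) :
    detForm f (exteriorPower.ιMulti ℤ r v) = (Matrix.of fun i j => f i (v j)).det := by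
  refine (exteriorPower.alternatingMapLinearEquiv_apply_ιMulti (detAlternating f) v).trans ?_
  rw [← Matrix.det_transpose]
  rfl

theorem map_detForm (θ : S →+* T) (f : Fin r → V →ₗ[ℤ] S) (g : Fin r → W →ₗ[ℤ] T)
    (p : V →ₗ[ℤ] W) (hfg : ∀ i v, g i (p v) = θ (f i v)) (u : ⋀[ℤ]^r V) :
    detForm g (exteriorPower.map r p u) = θ (detForm f u) := by
  have : detForm g ∘ₗ exteriorPower.map r p = θ.toAddMonoidHom.toIntLinearMap ∘ₗ detForm f := by
    apply exteriorPower.linearMap_ext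
    ext1 v
    change detForm g (exteriorPower.map r p (exteriorPower.ιMulti ℤ r v)) =
      θ (detForm f (exteriorPower.ιMulti ℤ r v))
    simp only [exteriorPower.map_apply_ιMulti, detForm_ιMulti, Function.comp_def, hfg]
    exact (RingHom.map_det θ _).symm
  exact LinearMap.congr_fun this u

theorem hsCoeff_ιMulti (D : ℕ → Module.End ℤ V) (n : ℕ) (v : Fin r → V) :
    hsCoeff r D n (exteriorPower.ιMulti ℤ r v) =
      ∑ k ∈ Finset.Nat.antidiagonalTuple r n,
        exteriorPower.ιMulti ℤ r fun j => D (k j) (v j) := by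
  ext1
  change PowerSeries.coeff n (hs D (ExteriorAlgebra.ιMulti ℤ r v)) = _
  rw [ExteriorAlgebra.ιMulti_apply, map_list_prod, List.map_ofFn, coeff_prod_ofFn,
    AddSubmonoidClass.coe_finsetSum]
  refine Finset.sum_congr rfl fun k _ => ?_
  simp [hs_ι, ExteriorAlgebra.ιMulti_apply]

/-- A determinantal form turns a Hasse-Schmidt derivation into a determinant of power series. -/
theorem mk_detForm_hsCoeff (f : Fin r → V →ₗ[ℤ] S) (D : ℕ → Module.End ℤ V) (v : Fin r → V) :
    (PowerSeries.mk fun n => detForm f (hsCoeff r D n (exteriorPower.ιMulti ℤ r v))) =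
      (Matrix.of fun i j => PowerSeries.mk fun n => f i (D n (v j))).det := by
  ext n
  rw [PowerSeries.coeff_mk, hsCoeff_ιMulti, map_sum, Matrix.det_apply, map_sum]
  simp_rw [detForm_ιMulti, Matrix.det_apply]
  rw [Finset.sum_comm]
  refine Finset.sum_congr rfl fun σ _ => ?_
  rw [← Finset.smul_sum, Units.smul_def, Units.smul_def, map_zsmul, ← List.prod_ofFn,
    coeff_prod_ofFn]
  simp [List.prod_ofFn]

theorem map_hsCoeff (D : ℕ → Module.End ℤ V) (D' : ℕ → Module.End ℤ W) (p : V →ₗ[ℤ] W)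
    (h : ∀ i v, p (D i v) = D' i (p v)) (i : ℕ) (u : ⋀[ℤ]^r V) :
    exteriorPower.map r p (hsCoeff r D i u) = hsCoeff r D' i (exteriorPower.map r p u) := by
  have : exteriorPower.map r p ∘ₗ hsCoeff r D i = hsCoeff r D' i ∘ₗ exteriorPower.map r p := by
    apply exteriorPower.linearMap_ext
    ext1 v
    simp only [LinearMap.compAlternatingMap_apply, LinearMap.comp_apply,
      exteriorPower.map_apply_ιMulti, hsCoeff_ιMulti, map_sum, Function.comp_def, h]
  exact LinearMap.congr_fun this u

theorem map_delta (A : Module.End ℤ V) (A' : Module.End ℤ W) (p : V →ₗ[ℤ] W)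
    (h : ∀ v, p (A v) = A' (p v)) (u : ⋀[ℤ]^r V) :
    exteriorPower.map r p (delta r A u) = delta r A' (exteriorPower.map r p u) := by
  refine map_hsCoeff _ _ p ?_ 1 u
  rintro (_ | _ | i) v
  · rfl
  · exact h v
  · simp [linSeq]

theorem extAct_ιMulti (A : Module.End ℤ V) : ∀ {r : ℕ} (v : Fin r → V),
    extAct A (ExteriorAlgebra.ιMulti ℤ r v) =
      ∑ k, ExteriorAlgebra.ιMulti ℤ r (Function.update v k (A (v k)))
  | 0, v => by simp [extAct]
  | r + 1, v => by
    rw [ExteriorAlgebra.ιMulti_succ_apply, extAct_mul, extAct_ι, extAct_ιMulti A,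
      Fin.sum_univ_succ, Finset.mul_sum]
    congr 1
    · rw [ExteriorAlgebra.ιMulti_succ_apply]
      simp [Matrix.vecTail, Function.comp_def]
    · refine Finset.sum_congr rfl fun k _ => ?_
      rw [ExteriorAlgebra.ιMulti_succ_apply, Function.update_of_ne (Fin.succ_ne_zero k).symm]
      congr 2
      ext j
      simp [Matrix.vecTail, Function.update_apply, Fin.succ_inj]

theorem delta_ιMulti (A : Module.End ℤ V) (v : Fin r → V) :
    delta r A (exteriorPower.ιMulti ℤ r v) =
      ∑ k, exteriorPower.ιMulti ℤ r (Function.update v k (A (v k))) := by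
  ext1
  rw [coe_delta, exteriorPower.ιMulti_apply_coe, extAct_ιMulti, AddSubmonoidClass.coe_finsetSum]
  rfl

theorem delta_zero (u : ⋀[ℤ]^r V) : delta r 0 u = 0 := by
  have : delta (V := V) (R := ℤ) r 0 = 0 := by
    apply exteriorPower.linearMap_ext
    ext1 v
    change delta r 0 (exteriorPower.ιMulti ℤ r v) = 0
    rw [delta_ιMulti]
    refine Finset.sum_eq_zero fun k _ => ?_
    rw [LinearMap.zero_apply]
    exact AlternatingMap.map_update_zero _ _ _
  rw [this]
  rfl

end DetForm

/-! ### The inverse of φ_r and its comparison with alternants in the Chern roots -/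

/-- The linear map `M → B_r`, `b_a ↦ h_{a-r+1+i}`. -/
def hRow (r : ℕ) (i : Fin r) : M →ₗ[ℤ] B r :=
  Finsupp.linearCombination ℤ fun a : ℕ => h r ((a : ℤ) - r + 1 + (i : ℕ))

theorem hRow_b (r : ℕ) (i : Fin r) (a : ℕ) : hRow r i (b a) = h r ((a : ℤ) - r + 1 + (i : ℕ)) := by
  simp [hRow, b]

/-- The inverse of `φ_r`. -/
def psi (r : ℕ) : ⋀[ℤ]^r M →ₗ[ℤ] B r := detForm (hRow r)

/-- The ring of polynomials in the Chern roots. -/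
abbrev RootRing (r : ℕ) : Type := MvPolynomial (Fin r) ℤ

/-- The embedding of `B_r` in the ring of polynomials in the Chern roots. -/
def toRoots (r : ℕ) : B r →+* RootRing r :=
  (MvPolynomial.aeval fun i : Fin r => MvPolynomial.esymm (Fin r) ℤ (i + 1)).toRingHom

/-- The elementary symmetric polynomials are algebraically independent. -/
theorem toRoots_injective (r : ℕ) : Function.Injective (toRoots r) := by
  intro p q hpq
  apply MvPolynomial.esymmAlgHom_fin_injective ℤ (le_refl r)
  ext1
  rw [MvPolynomial.esymmAlgHom_apply, MvPolynomial.esymmAlgHom_apply]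
  exact hpq

/-- `1 - x_k z`. -/
def rootFactor (r : ℕ) (k : Fin r) : PowerSeries (RootRing r) :=
  1 - PowerSeries.C (MvPolynomial.X k) * PowerSeries.X

theorem map_toRoots_E (r : ℕ) : (E r).map (toRoots r) = ∏ k, rootFactor r k := by
  have h1 : ∀ k, rootFactor r k = 1 + -(PowerSeries.C (MvPolynomial.X k) * PowerSeries.X) :=
    fun k => sub_eq_add_neg _ _
  simp_rw [h1, Finset.prod_one_add, Finset.sum_powerset, Finset.card_univ, Fintype.card_fin]
  rw [Finset.sum_range_succ', add_comm]
  simp only [Finset.powersetCard_zero, Finset.sum_singleton, Finset.prod_empty, E, map_add, map_one,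
    map_sum]
  congr 1
  rw [Finset.sum_range]
  refine Finset.sum_congr rfl fun i _ => ?_
  have h2 : ∀ t ∈ Finset.powersetCard ((i : ℕ) + 1) (Finset.univ : Finset (Fin r)),
      ∏ k ∈ t, -(PowerSeries.C (MvPolynomial.X k : RootRing r) * PowerSeries.X) =
      PowerSeries.C ((-1) ^ ((i : ℕ) + 1) * ∏ k ∈ t, MvPolynomial.X k) *
        PowerSeries.X ^ ((i : ℕ) + 1) := by
    intro t ht
    rw [Finset.prod_neg, Finset.prod_mul_distrib, Finset.prod_const,
      (Finset.mem_powersetCard.1 ht).2]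
    simp [mul_assoc]
  rw [Finset.sum_congr rfl h2, ← Finset.sum_mul, ← map_sum, ← Finset.mul_sum, map_mul, map_pow,
    PowerSeries.map_X, PowerSeries.map_C, map_mul]
  simp [toRoots, MvPolynomial.esymm]

theorem rootFactor_mul_mk_pow (r : ℕ) (k : Fin r) :
    rootFactor r k * (PowerSeries.mk fun n => (MvPolynomial.X k : RootRing r) ^ n) = 1 := by
  ext n
  rw [rootFactor, sub_mul, one_mul, mul_assoc, map_sub, PowerSeries.coeff_C_mul]
  cases n with
  | zero => simp
  | succ n => simp [PowerSeries.coeff_succ_X_mul, PowerSeries.coeff_one, pow_succ']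

theorem map_toRoots_invE (r : ℕ) :
    (invE r).map (toRoots r) =
      ∏ k, PowerSeries.mk fun n => (MvPolynomial.X k : RootRing r) ^ n := by
  have h1 : (∏ k, rootFactor r k) * (invE r).map (toRoots r) = 1 := by
    rw [← map_toRoots_E, ← map_mul, E_mul_invE, map_one]
  have h2 : (∏ k, rootFactor r k) *
      ∏ k, (PowerSeries.mk fun n => (MvPolynomial.X k : RootRing r) ^ n) = 1 := by
    rw [← Finset.prod_mul_distrib]
    exact Finset.prod_eq_one fun k _ => rootFactor_mul_mk_pow r k
  exact left_inv_eq_right_inv (by rw [mul_comm]; exact h1) h2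

theorem coeff_prod_rootFactor {r : ℕ} (s : Finset (Fin r)) {n : ℕ} (hn : s.card < n) :
    PowerSeries.coeff n (∏ k ∈ s, rootFactor r k) = 0 := by
  have : ∏ k ∈ s, rootFactor r k =
      ((∏ k ∈ s, (1 - Polynomial.C (MvPolynomial.X k) * Polynomial.X) :
        Polynomial (RootRing r)) : PowerSeries (RootRing r)) := by
    rw [← Polynomial.coeToPowerSeries.ringHom_apply, map_prod]
    simp [rootFactor]
  rw [this, Polynomial.coeff_coe]
  apply Polynomial.coeff_eq_zero_of_natDegree_lt
  refine lt_of_le_of_lt (Polynomial.natDegree_prod_le _ _) (lt_of_le_of_lt ?_ hn)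
  refine (Finset.sum_le_card_nsmul s _ 1 fun k _ => ?_).trans (by simp)
  compute_degree

/-- The linear map `M → ℤ[x_1, …, x_r]`, `b_a ↦ x_k ^ a`. -/
def rootEval (r : ℕ) (k : Fin r) : M →ₗ[ℤ] RootRing r :=
  Finsupp.linearCombination ℤ fun a : ℕ => (MvPolynomial.X k : RootRing r) ^ a

theorem rootEval_b (r : ℕ) (k : Fin r) (a : ℕ) :
    rootEval r k (b a) = MvPolynomial.X k ^ a := by
  simp [rootEval, b]

/-- The matrix expressing the powers of the Chern roots through the `h_j`. -/
def rootMatrix (r : ℕ) : Matrix (Fin r) (Fin r) (RootRing r) :=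
  Matrix.of fun k i => PowerSeries.coeff (i.rev : ℕ) (∏ m ∈ Finset.univ.erase k, rootFactor r m)

/-- Compare coefficients of z^a in 1/(1 - x_k z) = ∏_{m≠k} (1 - x_m z) / E_r(z). The point is that
`rootMatrix` does not depend on a. -/
theorem X_pow_eq_sum (r : ℕ) (k : Fin r) (a : ℕ) : (MvPolynomial.X k : RootRing r) ^ a =
    ∑ i, rootMatrix r k i * toRoots r (h r ((a : ℤ) - r + 1 + (i : ℕ))) := by
  have h1 : (PowerSeries.mk fun n => (MvPolynomial.X k : RootRing r) ^ n) =
      (∏ m ∈ Finset.univ.erase k, rootFactor r m) * (invE r).map (toRoots r) := by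
    rw [map_toRoots_invE, ← Finset.prod_erase_mul _ _ (Finset.mem_univ k), ← mul_assoc,
      ← Finset.prod_mul_distrib, Finset.prod_eq_one fun m _ => rootFactor_mul_mk_pow r m, one_mul]
  have h2 := congrArg (PowerSeries.coeff a) h1
  rw [PowerSeries.coeff_mk] at h2
  rw [h2, PowerSeries.coeff_mul, Finset.Nat.sum_antidiagonal_eq_sum_range_succ_mk,
    ← Equiv.sum_comp Fin.revPerm]
  have h3 : ∀ i : Fin r, rootMatrix r k (Fin.revPerm i) *
      toRoots r (h r ((a : ℤ) - r + 1 + ((Fin.revPerm i : Fin r) : ℕ))) =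
      (fun i : ℕ => PowerSeries.coeff i (∏ m ∈ Finset.univ.erase k, rootFactor r m) *
        toRoots r (h r ((a : ℤ) - i))) i := by
    intro i
    have : (a : ℤ) - r + 1 + ((Fin.revPerm i : Fin r) : ℕ) = a - (i : ℕ) := by
      rw [Fin.revPerm_apply, Fin.val_rev]
      omega
    rw [this, rootMatrix, Matrix.of_apply, Fin.revPerm_apply, Fin.rev_rev]
  rw [Finset.sum_congr rfl fun i _ => h3 i, Fin.sum_univ_eq_sum_range (fun i : ℕ =>
    PowerSeries.coeff i (∏ m ∈ Finset.univ.erase k, rootFactor r m) * toRoots r (h r ((a : ℤ) - i)))]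
  have h4 : ∀ i ∈ Finset.range (a + 1),
      PowerSeries.coeff i (∏ m ∈ Finset.univ.erase k, rootFactor r m) *
        PowerSeries.coeff (a - i) ((invE r).map (toRoots r)) =
      (fun i : ℕ => PowerSeries.coeff i (∏ m ∈ Finset.univ.erase k, rootFactor r m) *
        toRoots r (h r ((a : ℤ) - i))) i := by
    intro i hi
    have : (a : ℤ) - i = ((a - i : ℕ) : ℤ) := by
      have := Finset.mem_range.1 hi
      omega
    dsimp only
    rw [this, PowerSeries.coeff_map]
    rfl
  rw [Finset.sum_congr rfl h4]
  -- The sums run over i ≤ a and over i < r. The excess terms vanish: either h has negative index,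
  -- or i exceeds the degree r - 1 of the product of root factors.
  rcases le_total (a + 1) r with har | har
  · refine Finset.sum_subset (Finset.range_mono har) fun i _ hi => ?_
    have : (a : ℤ) - i = Int.negSucc (i - a - 1) := by
      have := mt Finset.mem_range.2 hi
      omega
    rw [this, h, map_zero, mul_zero]
  · refine (Finset.sum_subset (Finset.range_mono har) fun i _ hi => ?_).symm
    rw [coeff_prod_rootFactor, zero_mul]
    have := mt Finset.mem_range.2 hi
    have hk := k.2
    rw [Finset.card_erase_of_mem (Finset.mem_univ k), Finset.card_univ, Fintype.card_fin]
    omega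

theorem rootEval_eq_sum (r : ℕ) (k : Fin r) (v : M) :
    rootEval r k v = ∑ i, rootMatrix r k i * toRoots r (hRow r i v) := by
  induction v using Finsupp.induction_linear with
  | zero => simp
  | add v w hv hw => simp only [map_add, hv, hw, mul_add, Finset.sum_add_distrib]
  | single a c =>
    have : Finsupp.single a c = c • b a := by simp [b]
    rw [this]
    simp only [map_zsmul, rootEval_b, hRow_b, mul_smul_comm]
    rw [← Finset.smul_sum, X_pow_eq_sum]

/-- Multiplicativity of the determinant applied to the factorization of the matrix of powers. -/
theorem detForm_rootEval (r : ℕ) (u : ⋀[ℤ]^r M) :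
    detForm (rootEval r) u = (rootMatrix r).det * toRoots r (psi r u) := by
  have : detForm (rootEval r) =
      (LinearMap.mulLeft ℤ (rootMatrix r).det ∘ₗ (toRoots r).toAddMonoidHom.toIntLinearMap) ∘ₗ
        psi r := by
    apply exteriorPower.linearMap_ext
    ext1 v
    change detForm (rootEval r) (exteriorPower.ιMulti ℤ r v) =
      (rootMatrix r).det * toRoots r (psi r (exteriorPower.ιMulti ℤ r v))
    rw [psi, detForm_ιMulti, detForm_ιMulti, RingHom.map_det, ← Matrix.det_mul]
    congr 1
    ext1 i j
    simp only [Matrix.of_apply, Matrix.mul_apply, RingHom.mapMatrix_apply, Matrix.map_apply,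
      rootEval_eq_sum]
  exact LinearMap.congr_fun this u

/-! ### Injectivity and equivariance -/

theorem span_range_b : Submodule.span ℤ (Set.range b) = ⊤ :=
  (Finsupp.basisSingleOne (R := ℤ) (ι := ℕ)).span_eq

theorem exteriorPower_ext_b {r : ℕ} {N : Type} [AddCommGroup N] [Module ℤ N]
    {f g : ⋀[ℤ]^r M →ₗ[ℤ] N}
    (h : ∀ a : Fin r → ℕ, f (exteriorPower.ιMulti ℤ r fun i => b (a i)) =
      g (exteriorPower.ιMulti ℤ r fun i => b (a i))) : f = g := by
  apply LinearMap.ext_on (exteriorPower.ιMulti_span_of_span ℤ r M span_range_b)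
  rintro _ ⟨v, hv, rfl⟩
  choose a ha using fun i => hv ⟨i, rfl⟩
  obtain rfl : (fun i => b (a i)) = v := funext ha
  exact h a

/-- In the Leibniz expansion of det (x_k^{a_j}), the term of σ contributes to x^c exactly when a_j =
c_{σ j} for all j. For increasing c this reads off a coordinate in the basis of ⋀^r M. -/
theorem coeff_detForm_rootEval {r : ℕ} (c : Fin r → ℕ) (u : ⋀[ℤ]^r M) :
    MvPolynomial.coeff (Finsupp.equivFunOnFinite.symm c) (detForm (rootEval r) u) =
      detForm (fun k => Finsupp.lapply (c k)) u := by
  have : MvPolynomial.lcoeff ℤ (Finsupp.equivFunOnFinite.symm c) ∘ₗ detForm (rootEval r) =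
      detForm (fun k => Finsupp.lapply (c k)) := by
    apply exteriorPower_ext_b
    intro a
    rw [LinearMap.comp_apply, detForm_ιMulti, detForm_ιMulti, Matrix.det_apply, Matrix.det_apply,
      map_sum]
    refine Finset.sum_congr rfl fun σ _ => ?_
    rw [Units.smul_def, Units.smul_def, map_zsmul]
    congr 1
    simp only [Matrix.of_apply, rootEval_b]
    have h1 : ∏ j, (MvPolynomial.X (σ j) : RootRing r) ^ a j =
        MvPolynomial.monomial (Finsupp.equivFunOnFinite.symm (a ∘ σ.symm)) 1 := by
      rw [MvPolynomial.monomial_eq, map_one, one_mul, Finsupp.prod_fintype _ _ (by simp)]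
      simpa using Equiv.prod_comp σ fun k => (MvPolynomial.X k : RootRing r) ^ a (σ.symm k)
    rw [h1, MvPolynomial.lcoeff_apply, MvPolynomial.coeff_monomial]
    by_cases hac : a ∘ σ.symm = c
    · rw [if_pos (by rw [hac])]
      refine (Finset.prod_eq_one fun j _ => ?_).symm
      simp [← hac, b]
    · rw [if_neg (by simpa using hac)]
      obtain ⟨j, hj⟩ : ∃ j, a j ≠ c (σ j) := by
        by_contra! hall
        exact hac (funext fun k => by simpa using hall (σ.symm k))
      exact (Finset.prod_eq_zero (Finset.mem_univ j) (by simp [b, hj])).symm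
  exact LinearMap.congr_fun this u

theorem detForm_rootEval_injective (r : ℕ) : Function.Injective (detForm (rootEval r)) := by
  rw [injective_iff_map_eq_zero]
  intro u hu
  apply (Module.Basis.exteriorPower r (Finsupp.basisSingleOne (R := ℤ) (ι := ℕ))).ext_elem
  intro s
  rw [exteriorPower.basis_repr_apply, map_zero]
  have h1 := coeff_detForm_rootEval (Set.powersetCard.ofFinEmbEquiv.symm s) u
  rw [hu, MvPolynomial.coeff_zero] at h1
  rw [Finsupp.zero_apply, h1]
  refine LinearMap.congr_fun (f := exteriorPower.ιMultiDual ℤ r _ s) (g := detForm _) ?_ u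
  apply exteriorPower.linearMap_ext
  ext1 v
  refine (exteriorPower.ιMultiDual_apply_ιMulti _ _ _ _ _).trans ?_
  refine Eq.trans ?_ (detForm_ιMulti _ v).symm
  rw [← Matrix.det_transpose]
  rfl

theorem psi_wedge {r : ℕ} (lam : Fin r → ℕ) : psi r (wedge lam) = schur lam (h r) := by
  rw [psi, wedge, detForm_ιMulti, schur]
  congr 1
  ext1 i j
  rw [Matrix.of_apply, Matrix.of_apply, hRow_b, Fin.val_rev]
  congr 1
  omega

theorem h_zero (r : ℕ) : h r 0 = 1 := by
  change PowerSeries.coeff 0 (invE r) = 1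
  simp [invE]

theorem h_neg (r : ℕ) {k : ℤ} (hk : k < 0) : h r k = 0 := by
  obtain ⟨m, rfl⟩ := Int.eq_negSucc_of_lt_zero hk
  rfl

theorem schur_of_row {r : ℕ} (lam : Fin r → ℕ) (hlam : ∀ j : Fin r, 0 < (j : ℕ) → lam j = 0) :
    schur lam (h r) = ∏ j, h r (lam j) := by
  rw [schur, Matrix.det_of_isLowerTriangular]
  · simp
  · intro i j hij
    have hij' : (i : ℕ) < j := hij
    rw [Matrix.of_apply, hlam j (by omega), h_neg]
    omega

theorem schur_zero (r : ℕ) : schur (fun _ : Fin r => 0) (h r) = 1 := by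
  rw [schur_of_row _ fun _ _ => rfl]
  simp [h_zero]

theorem psi_injective (r : ℕ) : Function.Injective (psi r) := by
  rw [injective_iff_map_eq_zero]
  intro u hu
  apply detForm_rootEval_injective
  rw [detForm_rootEval, hu, map_zero, mul_zero, map_zero]

/-- Otherwise the alternant would vanish identically; being injective, it would force [b]_0 = 0,
whereas ψ([b]_0) = 1. -/
theorem det_rootMatrix_ne_zero (r : ℕ) : (rootMatrix r).det ≠ 0 := by
  intro h0
  have h1 : wedge (fun _ : Fin r => 0) = 0 := by
    apply detForm_rootEval_injective
    rw [detForm_rootEval, h0, zero_mul, map_zero]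
  have h2 := psi_wedge (fun _ : Fin r => 0)
  rw [schur_zero, h1, map_zero] at h2
  exact zero_ne_one h2

theorem rootEval_shift (r n : ℕ) (k : Fin r) (v : M) :
    rootEval r k (shift n v) = rootEval r k v * MvPolynomial.X k ^ n := by
  induction v using Finsupp.induction_linear with
  | zero => simp
  | add v w hv hw => simp only [map_add, hv, hw, add_mul]
  | single a c =>
    have : Finsupp.single a c = c • b a := by simp [b]
    have h2 : shift n (b a) = b (n + a) := by simp [shift, b]
    rw [this]
    simp only [map_zsmul, rootEval_b, h2]
    rw [smul_mul_assoc, pow_add, mul_comm]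

/-- Row k of the determinant for σ_+(z) acquires the factor 1/(1 - x_k z), and the product of these
factors is 1/E_r(z). -/
theorem detForm_rootEval_sigmaPlus (r : ℕ) (u : ⋀[ℤ]^r M) (n : ℕ) :
    detForm (rootEval r) (sigmaPlus r n u) =
      toRoots r (h r n) * detForm (rootEval r) u := by
  have : detForm (rootEval r) ∘ₗ sigmaPlus r n =
      LinearMap.mulLeft ℤ (toRoots r (h r n)) ∘ₗ detForm (rootEval r) := by
    apply exteriorPower.linearMap_ext
    ext1 v
    change detForm (rootEval r) (sigmaPlus r n (exteriorPower.ιMulti ℤ r v)) =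
      toRoots r (h r n) * detForm (rootEval r) (exteriorPower.ιMulti ℤ r v)
    have h1 := congrArg (PowerSeries.coeff n) (mk_detForm_hsCoeff (rootEval r) shift v)
    rw [PowerSeries.coeff_mk] at h1
    rw [sigmaPlus, h1]
    have h2 : (Matrix.of fun i j => PowerSeries.mk fun n => rootEval r i (shift n (v j))) =
        Matrix.of fun i j => (PowerSeries.mk fun n => (MvPolynomial.X i : RootRing r) ^ n) *
          (PowerSeries.C.mapMatrix (Matrix.of fun i j => rootEval r i (v j))) i j := by
      ext1 i j
      ext1 m
      simp [rootEval_shift, PowerSeries.coeff_mul_C, mul_comm]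
    rw [h2, Matrix.det_mul_column, ← RingHom.map_det, ← map_toRoots_invE,
      PowerSeries.coeff_mul_C, PowerSeries.coeff_map, detForm_ιMulti]
    rfl
  exact LinearMap.congr_fun this u

theorem psi_sigmaPlus (r n : ℕ) (u : ⋀[ℤ]^r M) :
    psi r (sigmaPlus r n u) = h r n * psi r u := by
  apply toRoots_injective
  apply mul_left_cancel₀ (det_rootMatrix_ne_zero r)
  rw [← detForm_rootEval, detForm_rootEval_sigmaPlus, detForm_rootEval, map_mul]
  ring

/-! ### Generation by the h_i: surjectivity and uniqueness -/

theorem coeff_E_succ {r : ℕ} (i : Fin r) :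
    PowerSeries.coeff ((i : ℕ) + 1) (E r) = (-1) ^ ((i : ℕ) + 1) * MvPolynomial.X i := by
  simp only [E, map_add, map_sum, PowerSeries.coeff_C_mul, PowerSeries.coeff_X_pow,
    PowerSeries.coeff_one]
  rw [Finset.sum_eq_single i]
  · simp
  · intro j _ hj
    rw [if_neg, mul_zero]
    intro h
    exact hj (Fin.ext (by omega))
  · simp

theorem coeff_E_eq_zero {r k : ℕ} (hk : r < k) : PowerSeries.coeff k (E r) = 0 := by
  simp only [E, map_add, map_sum, PowerSeries.coeff_C_mul, PowerSeries.coeff_X_pow,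
    PowerSeries.coeff_one]
  rw [if_neg (by omega), zero_add]
  refine Finset.sum_eq_zero fun i _ => ?_
  rw [if_neg (by omega), mul_zero]

theorem coeff_E_zero (r : ℕ) : PowerSeries.coeff 0 (E r) = 1 := by
  simp [E]

theorem coeff_invE (r k : ℕ) : PowerSeries.coeff k (invE r) = h r k := rfl

theorem sum_coeff_E_mul_h (r k : ℕ) (hk : 0 < k) :
    ∑ p ∈ Finset.range (k + 1), PowerSeries.coeff p (E r) * h r ((k - p : ℕ) : ℤ) = 0 := by
  have h1 := congrArg (PowerSeries.coeff k) (E_mul_invE r)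
  rw [PowerSeries.coeff_mul, Finset.Nat.sum_antidiagonal_eq_sum_range_succ_mk,
    PowerSeries.coeff_one, if_neg hk.ne'] at h1
  exact h1

/-- The recursion from E_r · (1/E_r) = 1 expresses each e_k through the h_i and earlier e_j, since
h_0 = 1. -/
theorem adjoin_h (r : ℕ) : Algebra.adjoin ℤ (Set.range fun i : ℕ => h r i) = ⊤ := by
  set A := Algebra.adjoin ℤ (Set.range fun i : ℕ => h r i) with hA
  have hh : ∀ i : ℕ, h r i ∈ A := fun i => Algebra.subset_adjoin ⟨i, rfl⟩
  have hE : ∀ k, PowerSeries.coeff k (E r) ∈ A := by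
    intro k
    induction k using Nat.strong_induction_on with
    | _ k ih =>
      rcases Nat.eq_zero_or_pos k with rfl | hk
      · rw [coeff_E_zero]
        exact one_mem A
      · have h1 := sum_coeff_E_mul_h r k hk
        rw [Finset.sum_range_succ, Nat.sub_self, Nat.cast_zero, h_zero, mul_one] at h1
        rw [eq_neg_of_add_eq_zero_right h1]
        exact neg_mem (sum_mem fun p hp => mul_mem (ih p (Finset.mem_range.1 hp)) (hh _))
  rw [eq_top_iff, ← MvPolynomial.adjoin_range_X, Algebra.adjoin_le_iff]
  rintro _ ⟨i, rfl⟩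
  have h2 := mul_mem (pow_mem (neg_mem (one_mem A)) ((i : ℕ) + 1)) (hE ((i : ℕ) + 1))
  rw [coeff_E_succ, ← mul_assoc, ← mul_pow] at h2
  simpa using h2

/-- A subgroup stable under the `h_i` is stable under `B_r`. -/
theorem mul_mem_of_h_mul_mem {r : ℕ} {A : Type} [CommRing A] (f : B r →+* A) (K : AddSubgroup A)
    (hK : ∀ (i : ℕ), ∀ x ∈ K, f (h r i) * x ∈ K) (P : B r) : ∀ x ∈ K, f P * x ∈ K := by
  have hP : P ∈ Algebra.adjoin ℤ (Set.range fun i : ℕ => h r i) := by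
    rw [adjoin_h]
    trivial
  induction hP using Algebra.adjoin_induction with
  | mem x hx =>
    obtain ⟨i, rfl⟩ := hx
    exact hK i
  | algebraMap c =>
    intro x hx
    rw [eq_intCast, map_intCast, ← zsmul_eq_mul]
    exact K.zsmul_mem hx c
  | add p q _ _ hp hq =>
    intro x hx
    rw [map_add, add_mul]
    exact K.add_mem (hp x hx) (hq x hx)
  | mul p q _ _ hp hq =>
    intro x hx
    rw [map_mul, mul_assoc]
    exact hp _ (hq x hx)

theorem psi_surjective (r : ℕ) : Function.Surjective (psi r) := by
  intro P
  have := mul_mem_of_h_mul_mem (RingHom.id (B r)) (psi r).toAddMonoidHom.range ?_ P 1 ?_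
  · simpa using this
  · rintro i _ ⟨u, rfl⟩
    exact ⟨sigmaPlus r i u, psi_sigmaPlus r i u⟩
  · exact ⟨wedge fun _ => 0, (psi_wedge _).trans (schur_zero r)⟩

/-- The isomorphism `⋀^r M ≃ B_r`. -/
def psiEquiv (r : ℕ) : ⋀[ℤ]^r M ≃ₗ[ℤ] B r :=
  LinearEquiv.ofBijective (psi r) ⟨psi_injective r, psi_surjective r⟩

theorem psiEquiv_apply (r : ℕ) (u : ⋀[ℤ]^r M) : psiEquiv r u = psi r u := rfl

theorem isPhi_psiEquiv_symm (r : ℕ) : IsPhi r (psiEquiv r).symm where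
  one := by
    rw [LinearEquiv.symm_apply_eq, psiEquiv_apply, psi_wedge, schur_zero]
  h_mul i P := by
    rw [LinearEquiv.symm_apply_eq, psiEquiv_apply, psi_sigmaPlus, ← psiEquiv_apply,
      LinearEquiv.apply_symm_apply]

theorem IsPhi.unique {r : ℕ} {φ φ' : B r ≃ₗ[ℤ] ⋀[ℤ]^r M} (hφ : IsPhi r φ) (hφ' : IsPhi r φ') :
    φ = φ' := by
  ext1 P
  have := mul_mem_of_h_mul_mem (RingHom.id (B r))
    (φ.toAddEquiv.toAddMonoidHom.eqLocus φ'.toAddEquiv.toAddMonoidHom) ?_ P 1 ?_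
  · rw [RingHom.id_apply, mul_one] at this
    exact this
  · intro i x (hx : φ x = φ' x)
    change φ (h r i * x) = φ' (h r i * x)
    rw [hφ.h_mul, hφ'.h_mul, hx]
  · exact hφ.one.trans hφ'.one.symm

theorem IsPhi.psi_apply {r : ℕ} {φ : B r ≃ₗ[ℤ] ⋀[ℤ]^r M} (hφ : IsPhi r φ) (P : B r) :
    psi r (φ P) = P := by
  rw [hφ.unique (isPhi_psiEquiv_symm r)]
  exact (psiEquiv r).apply_symm_apply P

theorem IsPhi.symm_apply {r : ℕ} {φ : B r ≃ₗ[ℤ] ⋀[ℤ]^r M} (hφ : IsPhi r φ) (u : ⋀[ℤ]^r M) :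
    φ.symm u = psi r u := by
  rw [LinearEquiv.symm_apply_eq]
  apply psi_injective
  rw [hφ.psi_apply]

theorem IsPhi.apply_schur {r : ℕ} {φ : B r ≃ₗ[ℤ] ⋀[ℤ]^r M} (hφ : IsPhi r φ) (lam : Fin r → ℕ) :
    φ (schur lam (h r)) = wedge lam := by
  apply psi_injective
  rw [hφ.psi_apply, psi_wedge]

/-! ### The truncation to `M_n` -/

/-- Beyond the generators, E_r of degree r expresses h_k through the r preceding terms, all of index
at least n - r + 1. -/
theorem h_mem_I {r n : ℕ} (k : ℕ) (hk : n + 1 ≤ k + r) : h r k ∈ I r n := by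
  induction k using Nat.strong_induction_on with
  | _ k ih =>
    rcases le_or_gt k n with hkn | hkn
    · exact Ideal.subset_span ⟨k, hk, hkn, rfl⟩
    · have h1 := sum_coeff_E_mul_h r k (by omega)
      rw [Finset.sum_range_succ', coeff_E_zero, one_mul] at h1
      change _ + h r (k : ℤ) = 0 at h1
      rw [eq_neg_of_add_eq_zero_right h1]
      refine neg_mem (sum_mem fun p hp => ?_)
      have hp' := Finset.mem_range.1 hp
      rcases le_or_gt (p + 1) r with hpr | hpr
      · exact Ideal.mul_mem_left _ _ (ih _ (by omega) (by omega))
      · rw [coeff_E_eq_zero hpr, zero_mul]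
        exact zero_mem _

/-- The linear map `M_n → B_{r,n}`, `b_a ↦ h_{a-r+1+i}`. -/
def hRowN (r n : ℕ) (i : Fin r) : Mn n →ₗ[ℤ] Bn r n :=
  Finsupp.linearCombination ℤ fun a : Fin n => pi r n (h r (((a : ℕ) : ℤ) - r + 1 + (i : ℕ)))

theorem proj_b (n a : ℕ) : proj n (b a) = bn n a := by
  simp [proj, b]

theorem hRowN_proj {r n : ℕ} (hrn : r ≤ n) (i : Fin r) (v : M) :
    hRowN r n i (proj n v) = pi r n (hRow r i v) := by
  induction v using Finsupp.induction_linear with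
  | zero => simp
  | add v w hv hw => simp only [map_add, hv, hw]
  | single a c =>
    have : Finsupp.single a c = c • b a := by simp [b]
    rw [this]
    simp only [map_zsmul, hRow_b, proj_b]
    congr 1
    by_cases ha : a < n
    · simp [hRowN, bn, ha]
    · rw [bn, dif_neg ha, map_zero]
      symm
      have h1 : (a : ℤ) - r + 1 + (i : ℕ) = ((a - r + 1 + i : ℕ) : ℤ) := by omega
      rw [h1]
      exact Ideal.Quotient.eq_zero_iff_mem.2 (h_mem_I _ (by omega))

/-- The inverse of `φ_{r,n}`. -/
def psiN (r n : ℕ) : ⋀[ℤ]^r (Mn n) →ₗ[ℤ] Bn r n := detForm (hRowN r n)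

theorem psiN_map_proj {r n : ℕ} (hrn : r ≤ n) (u : ⋀[ℤ]^r M) :
    psiN r n (exteriorPower.map r (proj n) u) = pi r n (psi r u) :=
  map_detForm (pi r n) (hRow r) (hRowN r n) (proj n) (hRowN_proj hrn) u

theorem proj_surjective (n : ℕ) : Function.Surjective (proj n) := by
  rw [← LinearMap.range_eq_top, proj, Finsupp.range_linearCombination, eq_top_iff,
    ← (Finsupp.basisSingleOne (R := ℤ) (ι := Fin n)).span_eq]
  apply Submodule.span_mono
  rintro _ ⟨a, rfl⟩
  exact ⟨a, by simp [bn]⟩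

theorem map_proj_surjective (r n : ℕ) :
    Function.Surjective (exteriorPower.map (R := ℤ) r (proj n)) :=
  exteriorPower.map_surjective (proj_surjective n)

theorem proj_shift (n i : ℕ) (v : M) : proj n (shift i v) = shiftn n i (proj n v) := by
  induction v using Finsupp.induction_linear with
  | zero => simp
  | add v w hv hw => simp only [map_add, hv, hw]
  | single a c =>
    have : Finsupp.single a c = c • b a := by simp [b]
    have h2 : shift i (b a) = b (i + a) := by simp [shift, b]
    rw [this]
    simp only [map_zsmul, h2, proj_b]
    congr 1
    by_cases ha : a < n
    · simp [shiftn, bn, ha]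
    · rw [bn, dif_neg (by omega), bn, dif_neg ha, map_zero]

theorem map_proj_sigmaPlus (r n i : ℕ) (u : ⋀[ℤ]^r M) :
    exteriorPower.map r (proj n) (sigmaPlus r i u) =
      sigmaPlusN r n i (exteriorPower.map r (proj n) u) :=
  map_hsCoeff _ _ _ (proj_shift n) i u

theorem map_proj_wedge (n : ℕ) {r : ℕ} (lam : Fin r → ℕ) :
    exteriorPower.map r (proj n) (wedge lam) = wedgeN n lam := by
  rw [wedge, exteriorPower.map_apply_ιMulti, wedgeN]
  simp [Function.comp_def, proj_b]

/-- `σ_n M ∧ ⋀^{r-1} M`. -/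
def sigmaWedge (r n : ℕ) : Submodule ℤ (ExteriorAlgebra ℤ M) :=
  (sigmaM n).map (ExteriorAlgebra.ι ℤ) * ⋀[ℤ]^(r - 1) M

theorem shift_mem_sigmaM {n : ℕ} (i : ℕ) {v : M} (hv : v ∈ sigmaM n) : shift i v ∈ sigmaM n := by
  have : sigmaM n ≤ (sigmaM n).comap (shift i) := by
    rw [sigmaM, Submodule.span_le]
    rintro _ ⟨j, hj, rfl⟩
    have h2 : shift i (b j) = b (i + j) := by simp [shift, b]
    rw [SetLike.mem_coe, Submodule.mem_comap, h2]
    exact Submodule.subset_span ⟨i + j, by omega, rfl⟩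
  exact this hv

theorem coeff_hs_shift_mem {r n : ℕ} (i : ℕ) {x : ExteriorAlgebra ℤ M} (hx : x ∈ sigmaWedge r n) :
    PowerSeries.coeff i (hs shift x) ∈ sigmaWedge r n := by
  induction hx using Submodule.mul_induction_on' with
  | mem_mul_mem m hm y hy =>
    obtain ⟨v, hv, rfl⟩ := hm
    rw [map_mul, hs_ι, PowerSeries.coeff_mul]
    refine Submodule.sum_mem _ fun p _ => ?_
    rw [PowerSeries.coeff_mk]
    exact Submodule.mul_mem_mul ⟨_, shift_mem_sigmaM _ hv, rfl⟩ (coeff_hs_mem shift hy _)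
  | add x _ y _ hx hy =>
    rw [map_add, map_add]
    exact add_mem hx hy

theorem map_proj_eq_zero {r n : ℕ} {x : ExteriorAlgebra ℤ M} (hx : x ∈ sigmaWedge r n) :
    ExteriorAlgebra.map (proj n) x = 0 := by
  induction hx using Submodule.mul_induction_on' with
  | mem_mul_mem m hm y hy =>
    obtain ⟨v, hv, rfl⟩ := hm
    have : sigmaM n ≤ LinearMap.ker (proj n) := by
      rw [sigmaM, Submodule.span_le]
      rintro _ ⟨j, hj, rfl⟩
      rw [SetLike.mem_coe, LinearMap.mem_ker, proj_b, bn, dif_neg (by omega)]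
    rw [map_mul, ExteriorAlgebra.map_apply_ι, LinearMap.mem_ker.1 (this hv), map_zero, zero_mul]
  | add x _ y _ hx hy => rw [map_add, hx, hy, add_zero]

theorem coe_map_proj {r n : ℕ} (u : ⋀[ℤ]^r M) :
    (exteriorPower.map r (proj n) u : ExteriorAlgebra ℤ (Mn n)) =
      ExteriorAlgebra.map (proj n) (u : ExteriorAlgebra ℤ M) := by
  have : (⋀[ℤ]^r (Mn n)).subtype ∘ₗ exteriorPower.map r (proj n) =
      (ExteriorAlgebra.map (proj n)).toLinearMap ∘ₗ (⋀[ℤ]^r M).subtype := by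
    apply exteriorPower.linearMap_ext
    ext1 v
    change (exteriorPower.map r (proj n) (exteriorPower.ιMulti ℤ r v) :
      ExteriorAlgebra ℤ (Mn n)) = ExteriorAlgebra.map (proj n) (ExteriorAlgebra.ιMulti ℤ r v)
    rw [exteriorPower.map_apply_ιMulti, ExteriorAlgebra.map_apply_ιMulti]
    rfl
  exact LinearMap.congr_fun this u

theorem exists_wedge_eq_h {r n : ℕ} (hr : 1 ≤ r) (k : ℕ) (hk : n + 1 ≤ k + r) :
    ∃ u : ⋀[ℤ]^r M, psi r u = h r k ∧ (u : ExteriorAlgebra ℤ M) ∈ sigmaWedge r n := by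
  obtain ⟨m, rfl⟩ : ∃ m, r = m + 1 := ⟨r - 1, by omega⟩
  -- For λ = (k, 0, …, 0) the first factor is b_{r-1+k}, and r - 1 + k ≥ n.
  refine ⟨wedge fun j => if (j : ℕ) = 0 then k else 0, ?_, ?_⟩
  · rw [psi_wedge, schur_of_row _ fun j hj => if_neg hj.ne', Fin.prod_univ_succ]
    simp [h_zero]
  · rw [wedge, exteriorPower.ιMulti_apply_coe, ExteriorAlgebra.ιMulti_succ_apply]
    refine Submodule.mul_mem_mul ⟨_, Submodule.subset_span ⟨_, ?_, rfl⟩, rfl⟩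
      (ExteriorAlgebra.ιMulti_range ℤ m ⟨_, rfl⟩)
    simp
    omega

/-- The image of σ_n M ∧ ⋀^{r-1} M under ψ contains the generators of I_{r,n} and is stable under
the h_i, hence contains the ideal; injectivity of ψ transfers this to u. -/
theorem mem_sigmaWedge_of_psi_mem {r n : ℕ} (hr : 1 ≤ r) (u : ⋀[ℤ]^r M) (hu : psi r u ∈ I r n) :
    (u : ExteriorAlgebra ℤ M) ∈ sigmaWedge r n := by
  let K : AddSubgroup (B r) :=
    (((sigmaWedge r n).comap (⋀[ℤ]^r M).subtype).toAddSubgroup).map (psi r).toAddMonoidHom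
  have key : ∀ P ∈ I r n, P ∈ K := by
    intro P hP
    induction hP using Submodule.span_induction with
    | mem x hx =>
      obtain ⟨k, hk, -, rfl⟩ := hx
      obtain ⟨u, hu, hu'⟩ := exists_wedge_eq_h hr k hk
      exact ⟨u, hu', hu⟩
    | zero => exact zero_mem K
    | add x y _ _ hx hy => exact add_mem hx hy
    | smul P x _ hx =>
      refine mul_mem_of_h_mul_mem (RingHom.id (B r)) K ?_ P x hx
      rintro i _ ⟨u, hu, rfl⟩
      exact ⟨sigmaPlus r i u, coeff_hs_shift_mem i hu, psi_sigmaPlus r i u⟩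
  obtain ⟨u', hu', h⟩ := key _ hu
  rw [← psi_injective r h]
  exact hu'

theorem exists_psi_mem_of_mem_sigmaWedge {r n : ℕ} (hr : 1 ≤ r) (hrn : r ≤ n)
    {x : ExteriorAlgebra ℤ M} (hx : x ∈ sigmaWedge r n) :
    ∃ u : ⋀[ℤ]^r M, (u : ExteriorAlgebra ℤ M) = x ∧ psi r u ∈ I r n := by
  have hmem : x ∈ ⋀[ℤ]^r M := by
    obtain ⟨m, rfl⟩ : ∃ m, r = m + 1 := ⟨r - 1, by omega⟩
    have h1 : sigmaWedge (m + 1) n ≤ ⋀[ℤ]^(m + 1) M := by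
      change _ ≤ (ExteriorAlgebra.ι ℤ).range ^ (m + 1)
      rw [pow_succ']
      exact mul_le_mul' LinearMap.map_le_range le_rfl
    exact h1 hx
  refine ⟨⟨x, hmem⟩, rfl, ?_⟩
  have h2 : exteriorPower.map r (proj n) (⟨x, hmem⟩ : ⋀[ℤ]^r M) = 0 := by
    ext1
    rw [coe_map_proj]
    exact map_proj_eq_zero hx
  rw [← Ideal.Quotient.eq_zero_iff_mem]
  change pi r n _ = 0
  rw [← psiN_map_proj hrn, h2, map_zero]

theorem psiN_injective {r n : ℕ} (hrn : r ≤ n) : Function.Injective (psiN r n) := by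
  rw [injective_iff_map_eq_zero]
  intro x hx
  obtain ⟨u, rfl⟩ := map_proj_surjective r n x
  rw [psiN_map_proj hrn] at hx
  have hu : psi r u ∈ I r n := Ideal.Quotient.eq_zero_iff_mem.1 hx
  -- For r = 0 the range of generators is empty, so the ideal is zero and injectivity of ψ suffices.
  rcases Nat.eq_zero_or_pos r with rfl | hr
  · have h0 : I 0 n = ⊥ := by
      rw [I, Ideal.span_eq_bot]
      rintro _ ⟨k, hk, hk', rfl⟩
      omega
    rw [h0, Ideal.mem_bot] at hu
    rw [psi_injective 0 (hu.trans (map_zero _).symm), map_zero]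
  · ext1
    rw [coe_map_proj]
    exact map_proj_eq_zero (mem_sigmaWedge_of_psi_mem hr u hu)

theorem psiN_surjective {r n : ℕ} (hrn : r ≤ n) : Function.Surjective (psiN r n) := by
  intro P
  obtain ⟨P, rfl⟩ := Ideal.Quotient.mk_surjective P
  obtain ⟨u, rfl⟩ := psi_surjective r P
  exact ⟨_, psiN_map_proj hrn u⟩

/-- The isomorphism `⋀^r M_n ≃ B_{r,n}`. -/
def psiNEquiv {r n : ℕ} (hrn : r ≤ n) : ⋀[ℤ]^r (Mn n) ≃ₗ[ℤ] Bn r n :=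
  LinearEquiv.ofBijective (psiN r n) ⟨psiN_injective hrn, psiN_surjective hrn⟩

theorem psiNEquiv_apply {r n : ℕ} (hrn : r ≤ n) (u : ⋀[ℤ]^r (Mn n)) :
    psiNEquiv hrn u = psiN r n u := rfl

theorem psiN_sigmaPlusN {r n : ℕ} (hrn : r ≤ n) (i : ℕ) (u : ⋀[ℤ]^r (Mn n)) :
    psiN r n (sigmaPlusN r n i u) = pi r n (h r i) * psiN r n u := by
  obtain ⟨u, rfl⟩ := map_proj_surjective r n u
  rw [← map_proj_sigmaPlus, psiN_map_proj hrn, psiN_map_proj hrn, psi_sigmaPlus, map_mul]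

theorem psiN_wedgeN {r n : ℕ} (hrn : r ≤ n) (lam : Fin r → ℕ) :
    psiN r n (wedgeN n lam) = pi r n (schur lam (h r)) := by
  rw [← map_proj_wedge, psiN_map_proj hrn, psi_wedge]

theorem isPhiN_psiNEquiv_symm {r n : ℕ} (hrn : r ≤ n) : IsPhiN r n (psiNEquiv hrn).symm where
  one := by
    rw [LinearEquiv.symm_apply_eq, psiNEquiv_apply, psiN_wedgeN hrn, schur_zero, map_one]
  h_mul i P := by
    rw [LinearEquiv.symm_apply_eq, psiNEquiv_apply, psiN_sigmaPlusN hrn, ← psiNEquiv_apply hrn,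
      LinearEquiv.apply_symm_apply]

theorem IsPhiN.unique {r n : ℕ} {φ φ' : Bn r n ≃ₗ[ℤ] ⋀[ℤ]^r (Mn n)} (hφ : IsPhiN r n φ)
    (hφ' : IsPhiN r n φ') : φ = φ' := by
  ext1 P
  obtain ⟨P, rfl⟩ := Ideal.Quotient.mk_surjective P
  have := mul_mem_of_h_mul_mem (pi r n)
    (φ.toAddEquiv.toAddMonoidHom.eqLocus φ'.toAddEquiv.toAddMonoidHom) ?_ P 1 ?_
  · rw [mul_one] at this
    exact this
  · intro i x (hx : φ x = φ' x)
    change φ (pi r n (h r i) * x) = φ' (pi r n (h r i) * x)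
    rw [hφ.h_mul, hφ'.h_mul, hx]
  · exact hφ.one.trans hφ'.one.symm

theorem IsPhiN.symm_apply {r n : ℕ} (hrn : r ≤ n) {φ : Bn r n ≃ₗ[ℤ] ⋀[ℤ]^r (Mn n)}
    (hφ : IsPhiN r n φ) (u : ⋀[ℤ]^r (Mn n)) : φ.symm u = psiN r n u := by
  rw [hφ.unique (isPhiN_psiNEquiv_symm hrn)]
  rfl

theorem IsPhiN.apply_pi {r n : ℕ} (hrn : r ≤ n) {φ : B r ≃ₗ[ℤ] ⋀[ℤ]^r M}
    {φn : Bn r n ≃ₗ[ℤ] ⋀[ℤ]^r (Mn n)} (hφ : IsPhi r φ) (hφn : IsPhiN r n φn) (P : B r) :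
    φn (pi r n P) = exteriorPower.map r (proj n) (φ P) := by
  rw [← LinearEquiv.eq_symm_apply, hφn.symm_apply hrn, psiN_map_proj hrn, hφ.psi_apply]

theorem IsPhi.map_I {r n : ℕ} (hr : 1 ≤ r) (hrn : r ≤ n) {φ : B r ≃ₗ[ℤ] ⋀[ℤ]^r M}
    (hφ : IsPhi r φ) :
    ((I r n).restrictScalars ℤ).map ((⋀[ℤ]^r M).subtype ∘ₗ φ.toLinearMap) = sigmaWedge r n := by
  apply le_antisymm
  · rintro _ ⟨P, hP, rfl⟩
    refine mem_sigmaWedge_of_psi_mem hr (φ P) ?_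
    rw [hφ.psi_apply]
    exact hP
  · intro x hx
    obtain ⟨u, rfl, hu⟩ := exists_psi_mem_of_mem_sigmaWedge hr hrn hx
    refine ⟨psi r u, hu, ?_⟩
    rw [← hφ.symm_apply]
    simp

/-! ### Determinants -/

section Determinants

variable {S : Type} [CommRing S] {m : ℕ}

/-- Cofactor expansion, with each cofactor written as a full-size determinant having a unit column
so that it can be recognized as a value of ψ. -/
theorem det_updateRow_eq_sum (A : Matrix (Fin m) (Fin m) S) (i : Fin m) (c : Fin m → S) :
    (A.updateRow i c).det = ∑ k, c k * (A.updateCol k (Pi.single i 1)).det := by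
  rw [Matrix.det_eq_sum_mul_adjugate_row _ i]
  refine Finset.sum_congr rfl fun k _ => ?_
  rw [Matrix.updateRow_self, Matrix.adjugate_apply, Matrix.updateRow_idem, ← Matrix.adjugate_apply,
    ← Matrix.cramer_apply, Matrix.cramer_eq_adjugate_mulVec, Matrix.mulVec_single_one]
  rfl

theorem det_updateCol_eq_sum (A : Matrix (Fin m) (Fin m) S) (k : Fin m) (u : Fin m → S) :
    (A.updateCol k u).det = ∑ l, A.adjugate k l * u l := by
  rw [← Matrix.cramer_apply, Matrix.cramer_eq_adjugate_mulVec]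
  rfl

/-- Row reduction of the determinants with one column replaced by `1, t, t ^ 2, …`. -/
theorem sum_det_updateCol_pow (A : Matrix (Fin (m + 1)) (Fin (m + 1)) S) (c : Fin (m + 1) → S)
    (t : S) :
    ∑ k, c k * (A.updateCol k fun i => t ^ (i : ℕ)).det =
      (Matrix.of (Fin.cons c fun i j => A i.succ j - t * A i.castSucc j)).det := by
  set A' : Matrix (Fin (m + 1)) (Fin (m + 1)) S :=
    Matrix.of (Fin.cons (A 0) fun i j => A i.succ j - t * A i.castSucc j) with hA'
  have h1 : ∀ k, (A.updateCol k fun i => t ^ (i : ℕ)).det =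
      (A'.updateCol k (Pi.single 0 1)).det := by
    intro k
    refine Matrix.det_eq_of_forall_row_eq_smul_add_pred (fun _ => t) ?_ ?_
    · intro j
      rcases eq_or_ne j k with rfl | hj
      · simp
      · simp [Matrix.updateCol_ne hj, hA']
    · intro i j
      rcases eq_or_ne j k with rfl | hj
      · simp [pow_succ']
      · simp [Matrix.updateCol_ne hj, hA']
  rw [Finset.sum_congr rfl fun k _ => by rw [h1 k], ← det_updateRow_eq_sum]
  congr 1
  ext i j
  refine Fin.cases ?_ (fun i => ?_) i
  · simp
  · rw [Matrix.updateRow_ne (Fin.succ_ne_zero i)]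
    simp [hA']

theorem det_cons_eq_updateRow_last (A : Matrix (Fin (m + 1)) (Fin (m + 1)) S)
    (c : Fin (m + 1) → S) :
    (Matrix.of (Fin.cons c fun i : Fin m => A i.castSucc)).det =
      ((-1) ^ m : ℤ) • (A.updateRow (Fin.last m) c).det := by
  -- Moving the first row to the end is a cycle of length m + 1, of sign (-1)^m.
  have h1 : A.updateRow (Fin.last m) c =
      (Matrix.of (Fin.cons c fun i : Fin m => A i.castSucc)).submatrix (finRotate (m + 1)) id := by
    ext i j
    refine Fin.lastCases ?_ (fun i => ?_) i
    · simp
    · rw [Matrix.updateRow_ne (Fin.castSucc_lt_last i).ne]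
      simp
  rw [h1, Matrix.det_permute, sign_finRotate, zsmul_eq_mul, ← mul_assoc]
  simp [← mul_pow]

theorem schurW_eq_det (lam : Fin (m + 1) → ℕ) (W H : ℤ → S) :
    schurW lam W H = (Matrix.of (Fin.cons (fun j : Fin (m + 1) => W ((j : ℤ) - (lam j : ℤ)))
      fun (i : Fin m) (j : Fin (m + 1)) => H ((lam j : ℤ) - (j : ℤ) + (i : ℕ) + 1))).det := by
  rw [schurW]
  congr 1
  ext i j
  refine Fin.cases ?_ (fun i => ?_) i
  · simp
  · simp [add_assoc]

theorem schurW_eq_sum (lam : Fin (m + 1) → ℕ) (W H : ℤ → S) :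
    schurW lam W H = ((-1) ^ m : ℤ) • ∑ k : Fin (m + 1), W ((k : ℤ) - (lam k : ℤ)) *
      ((Matrix.of fun i j : Fin (m + 1) =>
        H ((lam j : ℤ) - (j : ℤ) + (i : ℕ) + 1)).updateCol k (Pi.single (Fin.last m) 1)).det := by
  rw [schurW_eq_det, ← det_updateRow_eq_sum _ _ fun k : Fin (m + 1) => W ((k : ℤ) - (lam k : ℤ)),
    ← det_cons_eq_updateRow_last]
  rfl

theorem schurW_sub_eq_sum {R : Type} [CommRing R] (lam : Fin (m + 1) → ℕ) (W : ℤ → S) (H : ℤ → R)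
    (f : R →+* S) (t : S) :
    (schurW lam W fun k => f (H k) - f (H (k - 1)) * t) =
      ∑ k : Fin (m + 1), W ((k : ℤ) - (lam k : ℤ)) * ∑ l : Fin (m + 1),
        f ((Matrix.of fun i j : Fin (m + 1) =>
          H ((lam j : ℤ) - (j : ℤ) + (i : ℕ))).adjugate k l) * t ^ (l : ℕ) := by
  rw [schurW_eq_det]
  refine Eq.trans ?_ ((sum_det_updateCol_pow (f.mapMatrix (Matrix.of fun i j : Fin (m + 1) =>
    H ((lam j : ℤ) - (j : ℤ) + (i : ℕ)))) (fun k => W ((k : ℤ) - (lam k : ℤ))) t).symm.trans ?_)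
  · congr 1
    ext i j
    refine Fin.cases ?_ (fun i => ?_) i
    · simp
    · simp [mul_comm, ← add_assoc]
  · refine Finset.sum_congr rfl fun k _ => ?_
    rw [det_updateCol_eq_sum, ← RingHom.map_adjugate]
    rfl

end Determinants

/-! ### Series in `z` and `w⁻¹` -/

section LaurentSeries

variable {R S : Type} [CommRing R] [CommRing S]

theorem zpw_add (k l : ℤ) : (zpw (k + l) : L R) = zpw k * zpw l := by
  simp [zpw]

theorem zpw_zero : (zpw 0 : L R) = 1 := rfl

theorem wpw_add (k l : ℤ) : (wpw (k + l) : L R) = wpw k * wpw l := by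
  simp [wpw, add_comm]

theorem zpw_natCast (k : ℕ) : (zpw (k : ℤ) : L R) = ofZ (PowerSeries.X ^ k) := by
  rw [ofZ, HahnSeries.ofPowerSeries_X_pow, zpw]

theorem zpw_neg_one_pow (k : ℕ) : (zpw (-1) : L R) ^ k = zpw (-(k : ℤ)) := by
  induction k with
  | zero => simp [zpw_zero]
  | succ k ih =>
    rw [pow_succ, ih, ← zpw_add]
    congr 1
    push_cast
    ring

/-- `ofZ` as a ring homomorphism. -/
def ofZHom : PowerSeries R →+* L R :=
  (HahnSeries.C : LaurentSeries R →+* L R).comp (HahnSeries.ofPowerSeries ℤ R)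

theorem ofZ_eq (f : PowerSeries R) : ofZ f = ofZHom f := rfl

theorem cst_eq_ofZ (a : R) : cst a = ofZ (PowerSeries.C a) := by
  simp [ofZ, cst]

/-- `mapL` as a ring homomorphism. -/
def mapLHom (f : R →+* S) : L R →+* L S where
  toFun := mapL f
  map_one' := by
    ext i j
    simp only [mapL, HahnSeries.map_coeff, HahnSeries.coeff_one]
    split_ifs <;> simp [HahnSeries.coeff_one, apply_ite f]
  map_zero' := by
    ext i j
    simp [mapL]
  map_add' x y := by
    ext i j
    simp [mapL]
  map_mul' x y := by
    let g : LaurentSeries R →ₙ+* LaurentSeries S :=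
      { toFun := fun y => y.map f
        map_zero' := by ext; simp
        map_add' := fun x y => by ext; simp
        map_mul' := fun x y => HahnSeries.map_mul (f : R →ₙ+* S) }
    exact HahnSeries.map_mul g

theorem mapL_eq (f : R →+* S) (x : L R) : mapL f x = mapLHom f x := rfl

theorem map_coe_powerSeries (f : R →+* S) (p : PowerSeries R) :
    (HahnSeries.ofPowerSeries ℤ R p).map f = HahnSeries.ofPowerSeries ℤ S (p.map f) := by
  ext k
  rw [HahnSeries.map_coeff, PowerSeries.coeff_coe, PowerSeries.coeff_coe]
  split_ifs <;> simp

theorem map_single_zeroHom {A A' : Type} [Zero A] [Zero A'] (f : ZeroHom A A') (a : ℤ) (x : A) :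
    (HahnSeries.single a x).map f = HahnSeries.single a (f x) :=
  HahnSeries.map_single f

theorem mapL_ofZ (f : R →+* S) (p : PowerSeries R) : mapL f (ofZ p) = ofZ (p.map f) := by
  rw [ofZ, ofZ, ← map_coe_powerSeries]
  exact map_single_zeroHom _ _ _

theorem mapL_zpw (f : R →+* S) (k : ℤ) : mapL f (zpw k) = zpw k := by
  refine (map_single_zeroHom _ _ _).trans ?_
  change HahnSeries.single 0 ((HahnSeries.single k (1 : R)).map f) = _
  have h1 : (HahnSeries.single k (1 : R)).map f = HahnSeries.single k (1 : S) := by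
    ext j
    rw [HahnSeries.map_coeff, HahnSeries.coeff_single, HahnSeries.coeff_single]
    split_ifs <;> simp
  rw [h1]
  rfl

theorem mapL_wpw (f : R →+* S) (k : ℤ) : mapL f (wpw k) = wpw k := by
  refine (map_single_zeroHom _ _ _).trans ?_
  change HahnSeries.single (-k) ((1 : LaurentSeries R).map f) = _
  have h1 : (1 : LaurentSeries R).map f = 1 := by
    ext j
    rw [HahnSeries.map_coeff, HahnSeries.coeff_one, HahnSeries.coeff_one]
    split_ifs <;> simp
  rw [h1]
  rfl

theorem mapL_ofCoeffs (f : R →+* S) (a : ℕ → ℕ → R) :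
    mapL f (ofCoeffs a) = ofCoeffs fun i j => f (a i j) := by
  ext k l
  change (((ofCoeffs a).coeff k).map f).coeff l = _
  rw [ofCoeffs, ofCoeffs, PowerSeries.coeff_coe, PowerSeries.coeff_coe]
  split_ifs
  · simp
  · rw [PowerSeries.coeff_mk, PowerSeries.coeff_mk, map_coe_powerSeries]
    congr 2

/-- Series with finitely many powers of `w`. -/
theorem ofCoeffs_sum_ite {ι : Type} [Fintype ι] (e : ι → ℕ) (F : ι → ℕ → R) :
    (ofCoeffs fun i j => ∑ k, if j = e k then F k i else 0) =
      ∑ k, wpw (-(e k : ℤ)) * ofZ (PowerSeries.mk (F k)) := by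
  have h1 : (PowerSeries.mk fun j => HahnSeries.ofPowerSeries ℤ R
      (PowerSeries.mk fun i => ∑ k, if j = e k then F k i else 0)) =
      ∑ k, PowerSeries.X ^ e k *
        PowerSeries.C (HahnSeries.ofPowerSeries ℤ R (PowerSeries.mk (F k))) := by
    ext1 j
    rw [PowerSeries.coeff_mk, map_sum]
    have h2 : (PowerSeries.mk fun i => ∑ k, if j = e k then F k i else 0) =
        ∑ k, if j = e k then PowerSeries.mk (F k) else 0 := by
      ext i
      rw [PowerSeries.coeff_mk, map_sum]
      refine Finset.sum_congr rfl fun k _ => ?_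
      split_ifs <;> simp
    rw [h2, map_sum]
    refine Finset.sum_congr rfl fun k _ => ?_
    rw [PowerSeries.coeff_mul_C, PowerSeries.coeff_X_pow]
    split_ifs <;> simp
  rw [ofCoeffs, h1, map_sum]
  refine Finset.sum_congr rfl fun k _ => ?_
  rw [map_mul, HahnSeries.ofPowerSeries_X_pow, HahnSeries.ofPowerSeries_C, wpw, neg_neg]
  rfl

theorem ofZ_eq_sum (f : ℕ → R) (n : ℕ) (hf : ∀ i, n ≤ i → f i = 0) :
    ofZ (PowerSeries.mk f) = ∑ i : Fin n, cst (f i) * zpw ((i : ℕ) : ℤ) := by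
  have h1 : PowerSeries.mk f = ∑ i : Fin n, PowerSeries.C (f i) * PowerSeries.X ^ (i : ℕ) := by
    ext j
    simp only [PowerSeries.coeff_mk, map_sum, PowerSeries.coeff_C_mul, PowerSeries.coeff_X_pow]
    by_cases hj : j < n
    · rw [Finset.sum_eq_single ⟨j, hj⟩]
      · simp
      · intro i _ hi
        rw [if_neg, mul_zero]
        rintro rfl
        exact hi rfl
      · simp
    · rw [hf j (by omega)]
      refine (Finset.sum_eq_zero fun i _ => ?_).symm
      rw [if_neg (by omega), mul_zero]
  rw [h1, ofZ_eq, map_sum]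
  refine Finset.sum_congr rfl fun i _ => ?_
  rw [map_mul, zpw_natCast, cst_eq_ofZ, ofZ_eq, ofZ_eq]

theorem ofCoeffs_eq_sum (a : ℕ → ℕ → R) (n : ℕ) (hi : ∀ i j, n ≤ i → a i j = 0)
    (hj : ∀ i j, n ≤ j → a i j = 0) :
    ofCoeffs a = ∑ i : Fin n, ∑ j : Fin n,
      cst (a i j) * zpw ((i : ℕ) : ℤ) * wpw (-((j : ℕ) : ℤ)) := by
  have h1 : a = fun i j => ∑ k : Fin n, if j = (k : ℕ) then a i k else 0 := by
    ext i j
    by_cases hjn : j < n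
    · rw [Finset.sum_eq_single ⟨j, hjn⟩]
      · simp
      · intro k _ hk
        rw [if_neg]
        rintro rfl
        exact hk rfl
      · simp
    · rw [hj i j (by omega)]
      refine (Finset.sum_eq_zero fun k _ => ?_).symm
      rw [if_neg (by omega)]
  rw [Finset.sum_comm]
  conv_lhs => rw [h1]
  rw [ofCoeffs_sum_ite (fun k : Fin n => (k : ℕ)) fun k i => a i k]
  refine Finset.sum_congr rfl fun k _ => ?_
  rw [ofZ_eq_sum _ n fun i h => hi i k h, Finset.mul_sum]
  exact Finset.sum_congr rfl fun i _ => mul_comm _ _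

end LaurentSeries

/-! ### The operator `\bar σ_-(z)` -/

theorem sigmaBar_psi_ιMulti {r : ℕ} {φ : B r ≃ₗ[ℤ] ⋀[ℤ]^r M} (hφ : IsPhi r φ) (v : Fin r → M) :
    sigmaBar φ (psi r (exteriorPower.ιMulti ℤ r v)) =
      (Matrix.of fun i j =>
        cst (hRow r i (v j)) - cst (hRow r i (shiftDown (v j))) * zpw (-1)).det := by
  -- The indeterminate stands for z⁻¹: the determinant is computed over polynomials and then
  -- evaluated, because `L` has z⁻¹ as an element rather than as a power series variable.
  let p : Polynomial (B r) := (Matrix.of fun i j : Fin r =>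
    Polynomial.C (hRow r i (v j)) - Polynomial.C (hRow r i (shiftDown (v j))) * Polynomial.X).det
  have hp : (p : PowerSeries (B r)) = PowerSeries.mk fun n =>
      psi r (sigmaBarCoeff r n (exteriorPower.ιMulti ℤ r v)) := by
    refine Eq.trans ?_ (mk_detForm_hsCoeff (hRow r) (linSeq (-shiftDown)) v).symm
    rw [← Polynomial.coeToPowerSeries.ringHom_apply, RingHom.map_det]
    congr 1
    ext1 i j
    ext n
    rcases n with _ | _ | n
    · simp [linSeq]
    · simp [linSeq, PowerSeries.coeff_C]
    · simp [linSeq]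
  have hcoeff : ∀ n, p.coeff n = psi r (sigmaBarCoeff r n (exteriorPower.ιMulti ℤ r v)) := by
    intro n
    rw [← Polynomial.coeff_coe, hp, PowerSeries.coeff_mk]
  have hdeg : p.natDegree < r + 1 := by
    rw [Nat.lt_succ_iff, Polynomial.natDegree_le_iff_coeff_eq_zero]
    intro n hn
    rw [hcoeff, sigmaBarCoeff_eq_zero hn, map_zero]
  have hφu : φ (psi r (exteriorPower.ιMulti ℤ r v)) = exteriorPower.ιMulti ℤ r v := by
    rw [← hφ.symm_apply, LinearEquiv.apply_symm_apply]
  have h1 : sigmaBar φ (psi r (exteriorPower.ιMulti ℤ r v)) = p.eval₂ cst (zpw (-1)) := by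
    rw [Polynomial.eval₂_eq_sum_range' cst hdeg, sigmaBar]
    refine Finset.sum_congr rfl fun i _ => ?_
    rw [hφu, hφ.symm_apply, hcoeff, zpw_neg_one_pow]
  rw [h1, ← Polynomial.coe_eval₂RingHom, RingHom.map_det]
  congr 1
  ext1 i j
  simp [Polynomial.eval₂_sub, Polynomial.eval₂_mul]

/-- `sigmaBar` as a homomorphism of groups. -/
def sigmaBarHom {r : ℕ} (φ : B r ≃ₗ[ℤ] ⋀[ℤ]^r M) : B r →+ L (B r) where
  toFun := sigmaBar φ
  map_zero' := by simp [sigmaBar]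
  map_add' P Q := by simp [sigmaBar, add_mul, Finset.sum_add_distrib]

/-- `sigmaBarW` as a homomorphism of groups. -/
def sigmaBarWHom {r : ℕ} (φ : B r ≃ₗ[ℤ] ⋀[ℤ]^r M) : LaurentPolynomial (B r) →+ L (B r) where
  toFun := sigmaBarW φ
  map_zero' := by simp [sigmaBarW]
  map_add' x y := by
    rw [sigmaBarW, sigmaBarW, sigmaBarW]
    refine Finsupp.sum_add_index' (fun k => ?_) fun k P Q => ?_
    · exact (congrArg (wpw k * ·) (map_zero (sigmaBarHom φ))).trans (mul_zero _)
    · exact (congrArg (wpw k * ·) (map_add (sigmaBarHom φ) P Q)).trans (mul_add _ _ _)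

theorem sigmaBarW_T_mul_C {r : ℕ} (φ : B r ≃ₗ[ℤ] ⋀[ℤ]^r M) (k : ℤ) (P : B r) :
    sigmaBarW φ (LaurentPolynomial.T k * LaurentPolynomial.C P) = wpw k * sigmaBar φ P := by
  rw [LaurentPolynomial.T_mul, ← LaurentPolynomial.single_eq_C_mul_T, sigmaBarW]
  refine Finsupp.sum_single_index ?_
  exact (congrArg (wpw k * ·) (map_zero (sigmaBarHom φ))).trans (mul_zero _)

theorem shiftDown_b_zero : shiftDown (b 0) = 0 := by
  simp [shiftDown, b]

theorem shiftDown_b_succ (a : ℕ) : shiftDown (b (a + 1)) = b a := by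
  simp [shiftDown, b]

/-- The column of b_0 is (h_{-m}, …, h_0), a unit vector. -/
theorem hRow_b_zero {m : ℕ} (i : Fin (m + 1)) :
    hRow (m + 1) i (b 0) = (Pi.single (Fin.last m) 1 : Fin (m + 1) → B (m + 1)) i := by
  rw [hRow_b]
  refine Fin.lastCases ?_ (fun i => ?_) i
  · rw [Pi.single_eq_same, ← h_zero (m + 1)]
    congr 1
    simp
  · rw [Pi.single_eq_of_ne (Fin.castSucc_lt_last i).ne, h_neg]
    have := i.2
    simp only [Fin.val_castSucc]
    omega

theorem hRow_b_index {r : ℕ} (lam : Fin r → ℕ) (i j : Fin r) :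
    hRow r i (b ((j.rev : ℕ) + lam j)) = h r ((lam j : ℤ) - (j : ℤ) + (i : ℕ)) := by
  rw [hRow_b, Fin.val_rev]
  congr 1
  omega

theorem hRow_b_index_succ {r : ℕ} (lam : Fin r → ℕ) (i j : Fin r) :
    hRow r i (b ((j.rev : ℕ) + lam j + 1)) = h r ((lam j : ℤ) - (j : ℤ) + (i : ℕ) + 1) := by
  rw [hRow_b, Fin.val_rev]
  congr 1
  omega

theorem sigmaBarW_schurWH {m : ℕ} {φ : B (m + 1) ≃ₗ[ℤ] ⋀[ℤ]^(m + 1) M} (hφ : IsPhi (m + 1) φ)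
    (lam : Fin (m + 1) → ℕ) : sigmaBarW φ (schurWH lam) = schurWSigmaH lam := by
  rw [schurWH, schurWSigmaH, schurW_eq_sum, schurW_eq_sum]
  refine (map_zsmul (sigmaBarWHom φ) _ _).trans ?_
  rw [map_sum]
  congr 1
  refine Finset.sum_congr rfl fun k _ => ?_
  -- The cofactor of w^{k-λ_k} is, up to sign, ψ of this wedge: b_0 supplies the unit column, and
  -- raising the other indices by one supplies rows 2, …, r. Since σ̄_-(z) fixes b_0, the unit
  -- column survives.
  set v : Fin (m + 1) → M := Function.update (fun j => b ((j.rev : ℕ) + lam j + 1)) k (b 0) with hv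
  have h1 : ((Matrix.of fun i j : Fin (m + 1) => LaurentPolynomial.C (R := B (m + 1))
      (h (m + 1) ((lam j : ℤ) - (j : ℤ) + (i : ℕ) + 1))).updateCol k
        (Pi.single (Fin.last m) 1)).det =
      LaurentPolynomial.C (psi (m + 1) (exteriorPower.ιMulti ℤ (m + 1) v)) := by
    rw [psi, detForm_ιMulti, RingHom.map_det]
    congr 1
    ext1 i j
    rcases eq_or_ne j k with rfl | hj
    · simp [hv, hRow_b_zero, Pi.single_apply, apply_ite]
    · simp [-Fin.val_rev, hv, hj, hRow_b_index_succ]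
  rw [h1]
  refine (sigmaBarW_T_mul_C φ _ _).trans ?_
  rw [sigmaBar_psi_ιMulti hφ]
  congr 2
  ext1 i j
  rcases eq_or_ne j k with rfl | hj
  · simp [hv, hRow_b_zero, Pi.single_apply, apply_ite, shiftDown_b_zero]
  · simp [-Fin.val_rev, hv, hj, hRow_b_index_succ, shiftDown_b_succ, hRow_b_index]

/-! ### The generating series of the elementary endomorphisms -/

theorem act_apply {r : ℕ} {φ : B r ≃ₗ[ℤ] ⋀[ℤ]^r M} (hφ : IsPhi r φ) (A : Module.End ℤ M)
    (P : B r) : act φ A P = psi r (delta r A (φ P)) :=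
  hφ.symm_apply _

theorem actN_apply {r n : ℕ} (hrn : r ≤ n) {φn : Bn r n ≃ₗ[ℤ] ⋀[ℤ]^r (Mn n)} (hφn : IsPhiN r n φn)
    (A : Module.End ℤ (Mn n)) (P : Bn r n) : act φn A P = psiN r n (delta r A (φn P)) :=
  hφn.symm_apply hrn _

theorem elem_b (i j a : ℕ) : elem i j (b a) = if j = a then b i else 0 := by
  rw [elem, b, LinearMap.comp_apply, Finsupp.lapply_apply, Finsupp.single_apply]
  split_ifs with h1 h2 h2
  · rfl
  · exact absurd h1.symm h2
  · exact absurd h2.symm h1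
  · simp

theorem act_elem_schur {r : ℕ} {φ : B r ≃ₗ[ℤ] ⋀[ℤ]^r M} (hφ : IsPhi r φ) (lam : Fin r → ℕ)
    (i j : ℕ) : act φ (elem i j) (schur lam (h r)) =
      ∑ k : Fin r, if j = (k.rev : ℕ) + lam k then
        ∑ l : Fin r, (Matrix.of fun i j : Fin r =>
          h r ((lam j : ℤ) - (j : ℤ) + (i : ℕ))).adjugate k l * hRow r l (b i) else 0 := by
  rw [act_apply hφ, hφ.apply_schur, wedge, delta_ιMulti, map_sum]
  refine Finset.sum_congr rfl fun k _ => ?_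
  rw [elem_b]
  split_ifs with hj
  · rw [psi, detForm_ιMulti, ← det_updateCol_eq_sum]
    congr 1
    ext1 i' j'
    rcases eq_or_ne j' k with rfl | hj'
    · simp
    · simp [-Fin.val_rev, hj', hRow_b_index]
  · rw [AlternatingMap.map_update_zero, map_zero]

/-- The generating series of the replaced column; relative to z^m/E, its entries are the powers
z^{-l}. -/
theorem X_pow_mul_invE (m : ℕ) (l : Fin (m + 1)) :
    PowerSeries.X ^ (m - (l : ℕ)) * invE (m + 1) =
      PowerSeries.mk fun a => hRow (m + 1) l (b a) := by
  ext1 a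
  rw [PowerSeries.coeff_X_pow_mul', PowerSeries.coeff_mk, hRow_b]
  split_ifs with hla
  · rw [coeff_invE]
    congr 1
    have := l.2
    push_cast [hla]
    omega
  · rw [h_neg]
    push_cast
    omega

theorem genE_schur {m : ℕ} {φ : B (m + 1) ≃ₗ[ℤ] ⋀[ℤ]^(m + 1) M} (hφ : IsPhi (m + 1) φ)
    (lam : Fin (m + 1) → ℕ) :
    genE φ (schur lam (h (m + 1))) =
      zpw (m : ℤ) * wpw (-(m : ℤ)) * ofZ (invE (m + 1)) * schurWSigmaH lam := by
  set A : Matrix (Fin (m + 1)) (Fin (m + 1)) (B (m + 1)) :=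
    Matrix.of fun i j : Fin (m + 1) => h (m + 1) ((lam j : ℤ) - (j : ℤ) + (i : ℕ)) with hA
  have h1 : genE φ (schur lam (h (m + 1))) = ∑ k : Fin (m + 1),
      wpw (-(((k.rev : ℕ) + lam k : ℕ) : ℤ)) *
        ofZ (PowerSeries.mk fun i => ∑ l : Fin (m + 1), A.adjugate k l * hRow (m + 1) l (b i)) := by
    rw [genE, ← ofCoeffs_sum_ite]
    congr 1
    ext1 i
    ext1 j
    exact act_elem_schur hφ lam i j
  have h2 : (schurWSigmaH lam : L (B (m + 1))) = ∑ k : Fin (m + 1),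
      wpw ((k : ℤ) - (lam k : ℤ)) * ∑ l, cst (A.adjugate k l) * zpw (-((l : ℕ) : ℤ)) := by
    rw [schurWSigmaH, schurW_sub_eq_sum]
    simp_rw [zpw_neg_one_pow]
    rfl
  rw [h1, h2, Finset.mul_sum]
  refine Finset.sum_congr rfl fun k _ => ?_
  have h4 : (PowerSeries.mk fun i => ∑ l : Fin (m + 1), A.adjugate k l * hRow (m + 1) l (b i)) =
      ∑ l : Fin (m + 1), PowerSeries.C (A.adjugate k l) *
        (PowerSeries.X ^ (m - (l : ℕ)) * invE (m + 1)) := by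
    ext1 i
    simp [X_pow_mul_invE]
  have h5 : -(((k.rev : ℕ) + lam k : ℕ) : ℤ) = -(m : ℤ) + ((k : ℤ) - (lam k : ℤ)) := by
    have := k.2
    rw [Fin.val_rev]
    omega
  rw [h4, ofZ_eq, map_sum, h5, wpw_add, Finset.mul_sum, Finset.mul_sum, Finset.mul_sum]
  refine Finset.sum_congr rfl fun l _ => ?_
  have h6 : (zpw (m : ℤ) : L (B (m + 1))) = zpw ((m - (l : ℕ) : ℕ) : ℤ) * zpw ((l : ℕ) : ℤ) := by
    have := l.2
    rw [← zpw_add]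
    congr 1
    omega
  have h7 : (zpw ((l : ℕ) : ℤ) : L (B (m + 1))) * zpw (-((l : ℕ) : ℤ)) = 1 := by
    rw [← zpw_add, add_neg_cancel, zpw_zero]
  rw [map_mul, map_mul, h6, zpw_natCast (m - (l : ℕ)), cst_eq_ofZ, ofZ_eq, ofZ_eq, ofZ_eq]
  linear_combination (-(wpw (-(m : ℤ)) * wpw ((k : ℤ) - (lam k : ℤ)) *
    ofZHom (PowerSeries.C (A.adjugate k l)) * ofZHom (PowerSeries.X ^ (m - (l : ℕ))) *
    ofZHom (invE (m + 1)))) * h7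

/-! ### The truncation of the generating series -/

theorem psi_delta_eq_zero {r n : ℕ} (hrn : r ≤ n) (A : Module.End ℤ M)
    (hA : ∀ v, proj n (A v) = 0) (u : ⋀[ℤ]^r M) : pi r n (psi r (delta r A u)) = 0 := by
  rw [← psiN_map_proj hrn, map_delta A 0 (proj n) fun v => by rw [hA, LinearMap.zero_apply],
    delta_zero, map_zero]

theorem elem_apply (i j : ℕ) (v : M) : elem i j v = v j • b i := by
  simp [elem, b]

theorem proj_apply {n : ℕ} (v : M) (j : Fin n) : proj n v j = v j := by
  induction v using Finsupp.induction_linear with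
  | zero => simp
  | add v w hv hw => simp [hv, hw]
  | single a c =>
    have : Finsupp.single a c = c • b a := by simp [b]
    rw [this, map_zsmul, proj_b, bn, b]
    split_ifs with ha
    · simp [Finsupp.single_apply, Fin.ext_iff]
    · have : a ≠ j := fun h => ha (h ▸ j.2)
      simp [this]

theorem proj_elem {n : ℕ} (i j : Fin n) (v : M) :
    proj n (elem (i : ℕ) (j : ℕ) v) = elem i j (proj n v) := by
  rw [elem_apply, map_zsmul, proj_b, elem, LinearMap.comp_apply, Finsupp.lapply_apply, proj_apply,
    bn, dif_pos i.2]
  simp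

theorem genEn_eq {r n : ℕ} (hrn : r ≤ n) {φ : B r ≃ₗ[ℤ] ⋀[ℤ]^r M}
    {φn : Bn r n ≃ₗ[ℤ] ⋀[ℤ]^r (Mn n)} (hφ : IsPhi r φ) (hφn : IsPhiN r n φn)
    (lam : Fin r → ℕ) (hlam : ∀ i, lam i ≤ n - r) :
    genEn φn (schur lam fun k => pi r n (h r k)) = mapL (pi r n) (genE φ (schur lam (h r))) := by
  have h0 : (schur lam fun k => pi r n (h r k)) = pi r n (schur lam (h r)) := by
    rw [schur, schur, RingHom.map_det]
    rfl
  rw [h0, genE, mapL_ofCoeffs, ofCoeffs_eq_sum _ n, genEn]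
  · refine Finset.sum_congr rfl fun i _ => Finset.sum_congr rfl fun j _ => ?_
    congr 3
    rw [actN_apply hrn hφn, hφn.apply_pi hrn hφ, act_apply hφ, ← psiN_map_proj hrn,
      map_delta _ (elem i j) (proj n) (proj_elem i j)]
  -- For i ≥ n the image of ℰ_{ij} is killed by the projection to M_n.
  · intro i j hi
    rw [act_apply hφ]
    refine psi_delta_eq_zero hrn _ (fun v => ?_) _
    rw [elem_apply, map_zsmul, proj_b, bn, dif_neg (by omega), smul_zero]
  -- For j ≥ n no factor of [b]_λ equals b_j: the rectangle condition keeps every index below n.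
  · intro i j hj
    rw [act_elem_schur hφ, Finset.sum_eq_zero, map_zero]
    intro k _
    have := hlam k
    have := k.2
    rw [if_neg]
    rw [Fin.val_rev]
    omega

theorem mapL_ofZ_invE {r n : ℕ} (hrn : r ≤ n) :
    mapL (pi r n) (ofZ (invE r)) =
      ∑ k ∈ Finset.range (n - r + 1), cst (pi r n (h r k)) * zpw (k : ℤ) := by
  have h1 : (invE r).map (pi r n) = PowerSeries.mk fun k : ℕ => pi r n (h r k) := by
    ext k
    rw [PowerSeries.coeff_map, coeff_invE, PowerSeries.coeff_mk]
  rw [mapL_ofZ, h1, ofZ_eq_sum _ (n - r + 1), Finset.sum_range]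
  intro k hk
  exact Ideal.Quotient.eq_zero_iff_mem.2 (h_mem_I k (by omega))

end SchubertGL

end

open SchubertGL in
theorem theorem6p3 (r n : ℕ) (hrn : r ≤ n) :
    -- the identifications of `B_r` with `⋀^r M` and of `B_{r,n}` with `⋀^r M_n`
    (∃! φ : B r ≃ₗ[ℤ] ⋀[ℤ]^r M, IsPhi r φ) ∧
    (∃! φn : Bn r n ≃ₗ[ℤ] ⋀[ℤ]^r (Mn n), IsPhiN r n φn) ∧
    ∀ (φ : B r ≃ₗ[ℤ] ⋀[ℤ]^r M) (φn : Bn r n ≃ₗ[ℤ] ⋀[ℤ]^r (Mn n)), IsPhi r φ → IsPhiN r n φn →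
      -- Schur determinants correspond to the wedge basis; compatibility with the projections
      (∀ lam : Fin r → ℕ, Antitone lam → φ (schur lam (h r)) = wedge lam) ∧
      (∀ P : B r, φn (pi r n P) = exteriorPower.map r (proj n) (φ P)) ∧
      -- `I_{r,n} [b]^r_0 = σ_n M ∧ ⋀^{r-1} M`
      (1 ≤ r → ((I r n).restrictScalars ℤ).map ((⋀[ℤ]^r M).subtype ∘ₗ φ.toLinearMap) =
        (sigmaM n).map (ExteriorAlgebra.ι ℤ) * ⋀[ℤ]^(r - 1) M) ∧
      -- the description of the action, for partitions in the `r × (n - r)` rectangle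
      ∀ lam : Fin r → ℕ, Antitone lam → (∀ i, lam i ≤ n - r) →
        genEn φn (schur lam fun k => pi r n (h r k)) =
            mapL (pi r n) (genE φ (schur lam (h r))) ∧
        (1 ≤ r →
          genEn φn (schur lam fun k => pi r n (h r k)) =
            zpw ((r : ℤ) - 1) * wpw (1 - (r : ℤ)) * mapL (pi r n) (ofZ (invE r)) *
              mapL (pi r n) (sigmaBarW φ (schurWH lam)) ∧
          genEn φn (schur lam fun k => pi r n (h r k)) =
            zpw ((r : ℤ) - 1) * wpw (1 - (r : ℤ)) *
              (∑ k ∈ Finset.range (n - r + 1), cst (pi r n (h r k)) * zpw (k : ℤ)) *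
              mapL (pi r n) (sigmaBarW φ (schurWH lam)) ∧
          sigmaBarW φ (schurWH lam) = schurWSigmaH lam) := by
  refine ⟨⟨(psiEquiv r).symm, isPhi_psiEquiv_symm r, fun φ hφ => hφ.unique (isPhi_psiEquiv_symm r)⟩,
    ⟨(psiNEquiv hrn).symm, isPhiN_psiNEquiv_symm hrn,
      fun φ hφ => hφ.unique (isPhiN_psiNEquiv_symm hrn)⟩, ?_⟩
  intro φ φn hφ hφn
  refine ⟨fun lam _ => hφ.apply_schur lam, hφn.apply_pi hrn hφ, fun hr => hφ.map_I hr hrn,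
    fun lam _ hlam => ⟨genEn_eq hrn hφ hφn lam hlam, fun hr => ?_⟩⟩
  obtain ⟨m, rfl⟩ : ∃ m, r = m + 1 := ⟨r - 1, by omega⟩
  have h1 : genEn φn (schur lam fun k => pi (m + 1) n (h (m + 1) k)) =
      zpw (((m + 1 : ℕ) : ℤ) - 1) * wpw (1 - ((m + 1 : ℕ) : ℤ)) *
        mapL (pi (m + 1) n) (ofZ (invE (m + 1))) *
        mapL (pi (m + 1) n) (sigmaBarW φ (schurWH lam)) := by
    have e1 : ((m + 1 : ℕ) : ℤ) - 1 = m := by omega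
    have e2 : 1 - ((m + 1 : ℕ) : ℤ) = -(m : ℤ) := by omega
    rw [genEn_eq hrn hφ hφn lam hlam, genE_schur hφ, sigmaBarW_schurWH hφ, mapL_eq, map_mul,
      map_mul, map_mul, ← mapL_eq, ← mapL_eq, ← mapL_eq, ← mapL_eq, mapL_zpw, mapL_wpw, e1, e2]
  exact ⟨h1, by rw [h1, mapL_ofZ_invE hrn], sigmaBarW_schurWH hφ lam⟩
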